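/- Let $0\le\gamma\le\alpha\le1$. For $n\in\mathbb N=\{1,2,\dots\}$ let $\mathbb T_{[n]}$ be the set of rooted (non-planar) trees with $n$ leaves labelled $1,\dots,n$, whose root is an additional vertex of degree $1$ and in which every other non-leaf vertex (a branch point) has degree at least $3$, up to label-preserving isomorphism. Write $c_v$ for the number of children of a branch point $v$. An edge is external if it ends in a leaf; for $n\ge2$ every other edge, including the edge at the root, is internal, while the only edge of the tree with one leaf is external. **Growth process.** $T_1$ is the unique element of $\mathbb T_{[1]}$. Given $T_n=\mathbf s\in\mathbb T_{[n]}$, pick an edge or a branch point $x$ of $\mathbf s$ with probability $w_x/(n-\alpha)$, where $w_x=1-\alpha$ if $x$ is an external edge, $w_x=\gamma$ if $x$ is an internal edge, and $w_x=(c_x-1)\alpha-\gamma$ if $x$ is a branch point; for $n=1$ the only edge is picked with probability one (also if $\alpha=1$). Then $T_{n+1}$ is obtained by inserting leaf $n+1$ into $x$: if $x$ is an edge, a new branch point is placed on $x$ and leaf $n+1$ is attached to it; if $x$ is a branch point, leaf $n+1$ becomes a new child of $x$. The process $(T_n)_{n\ge1}$ is the $(\alpha,\gamma)$-growth process. **The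 chain.** Let $n\ge2$. The $(\alpha,\gamma)$-chain on $\mathbb T_{[n]}$ is the Markov chain with the following transition from $\mathbf t\in\mathbb T_{[n]}$. 1. Select a leaf $i\in[n]$ uniformly at random, and let $v$ be its parent. 2. If $c_v=2$, let $\tilde I=\max\{i,a,b\}$, where $a$ is the smallest label of the leaves descending from $v$ other than $i$, and $b$ is the smallest label of the leaves descending from the parent $v'$ of $v$ but not from $v$, with $b=0$ if $v'$ is the root. If $c_v\ge3$, let $i_1<\dots<i_{c_v}$ be the smallest leaf labels in the $c_v$ subtrees of $v$, let $j$ be such that $i=i_j$, and choose $\tilde I=i_{j'}$ with conditional probability $$\begin{cases}\dfrac{\alpha-\gamma}{(c_v-2)\alpha-\gamma}& j\le2,\ j'=3,\\[2mm] \dfrac{\alpha}{(c_v-2)\alpha-\gamma}& j\le 2,\ 3<j'\le c_v,\\[2mm] \dfrac{\alpha}{(c_v-2)\alpha-\gamma}& 2<j<j'\le c_v,\\[2mm] \dfrac{(j-2)\alpha-\gamma}{(c_v-2)\alpha-\gamma}& 2<j=j'\le c_v,\end{cases}$$ and $0$ otherwise. If the denominator vanishes (only for $\alpha=\gamma$ and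 $c_v=3$, or for $\alpha=\gamma=0$), choose $\tilde I=i_3$ if $j\le2$ and $\tilde I=i_j$ if $j\ge3$. 3. Swap the labels $i$ and $\tilde I$, and delete leaf $\tilde I$, contracting its parent if this is left with only one child. 4. Relabel $\tilde I+1,\dots,n$ by $\tilde I,\dots,n-1$, keeping the order. 5. Insert leaf $n$ into the resulting element of $\mathbb T_{[n-1]}$ according to the growth rule above. For $n=1$ the chain is constant, on the one-point set $\mathbb T_{[1]}$. **Proposition.** For every $n\in\mathbb N$ the $(\alpha,\gamma)$-chain on $\mathbb T_{[n]}$ started from $T_n$ is stationary: the law of $T_n$ is invariant under the transition kernel of the chain, and if $(T_n(m))_{m\ge0}$ is such a Markov chain with $T_n(0)\overset{d}{=}T_n$, then $(T_n(m+r))_{m\ge0}\overset{d}{=}(T_n(m))_{m\ge0}$ for every $r\ge0$. -/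

import Mathlib

open MeasureTheory
open scoped ENNReal

noncomputable section

namespace AlphaGamma

/-- A (non-planar) rooted multifurcating tree with `n ≥ 1` leaves, with the leaf labels
`1, …, n` written as the elements `0, …, n - 1` of `Fin n` (only the order of labels matters).
A tree is considered up to label-preserving isomorphism and is given by its clades: every vertex
other than the root is identified with the set of labels of the leaves above it.
Leaf `k` is the clade `{k}`, a branch point is a clade with at least two elements, and the vertex
adjacent to the root is the clade of all labels. A vertex is a descendant of another one iff its
clade is contained in the other. Since every branch point has at least two children, the tree is
determined by its clades, and the families of clades that occur are the following ones. The root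
(of degree 1) is not part of the data. -/
@[ext] structure LeafTree (n : ℕ) where
  clades : Finset (Finset (Fin n))
  univ_mem : Finset.univ ∈ clades
  singleton_mem : ∀ k : Fin n, {k} ∈ clades
  empty_notMem : ∅ ∉ clades
  nested : ∀ C ∈ clades, ∀ D ∈ clades, C ⊆ D ∨ D ⊆ C ∨ Disjoint C D

/-- The set of trees is a finite, discrete space. -/
instance (n : ℕ) : MeasurableSpace (LeafTree n) := ⊤

namespace LeafTree

variable {n : ℕ}

lemma nonempty_of_mem (t : LeafTree n) {C : Finset (Fin n)} (h : C ∈ t.clades) : C.Nonempty := by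
  rw [Finset.nonempty_iff_ne_empty]
  rintro rfl
  exact t.empty_notMem h

/-- The branch points of the tree. -/
def branchPoints (t : LeafTree n) : Finset (Finset (Fin n)) :=
  t.clades.filter fun C => 2 ≤ C.card

/-- The children of the vertex `v`. -/
def children (t : LeafTree n) (v : Finset (Fin n)) : Finset (Finset (Fin n)) :=
  t.clades.filter fun D => D ⊂ v ∧ ∀ E ∈ t.clades, D ⊂ E → ¬ E ⊂ v

/-- The number `c_v` of children of the vertex `v`. -/
def numChildren (t : LeafTree n) (v : Finset (Fin n)) : ℕ := (t.children v).card

/-- The parent of the vertex `C`, as the intersection of all clades strictly containing `C`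
(they form a chain). The vertex adjacent to the root has the root as its parent; here the value
is again the clade of all labels, as all labels lie above the root. -/
def parent (t : LeafTree n) (C : Finset (Fin n)) : Finset (Fin n) :=
  Finset.univ.filter fun k => ∀ D ∈ t.clades, C ⊂ D → k ∈ D

/-- The smallest leaf labels `i_1 < … < i_{c_v}` in the subtrees of `v`. -/
def leastLabels (t : LeafTree n) (v : Finset (Fin n)) : Finset (Fin n) :=
  Finset.univ.filter fun k => ∃ D ∈ t.children v, k ∈ D ∧ ∀ l ∈ D, k ≤ l

lemma children_disjoint (t : LeafTree n) {v C D : Finset (Fin n)} (hC : C ∈ t.children v)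
    (hD : D ∈ t.children v) (hne : C ≠ D) : Disjoint C D := by
  simp only [children, Finset.mem_filter] at hC hD
  rcases t.nested C hC.1 D hD.1 with h | h | h
  · exact absurd hD.2.1 (hC.2.2 D hD.1 (h.ssubset_of_ne hne))
  · exact absurd hC.2.1 (hD.2.2 C hC.1 (h.ssubset_of_ne hne.symm))
  · exact h

lemma card_leastLabels (t : LeafTree n) (v : Finset (Fin n)) :
    (t.leastLabels v).card = t.numChildren v := by
  symm
  have hne : ∀ D ∈ t.children v, D.Nonempty := fun D hD =>
    t.nonempty_of_mem (Finset.mem_filter.1 hD).1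
  refine Finset.card_bij (fun D hD => D.min' (hne D hD)) ?_ ?_ ?_
  · intro D hD
    simp only [leastLabels, Finset.mem_filter, Finset.mem_univ, true_and]
    exact ⟨D, hD, D.min'_mem _, fun l hl => D.min'_le l hl⟩
  · intro C hC D hD h
    by_contra hCD
    refine Finset.disjoint_left.1 (t.children_disjoint hC hD hCD) (C.min'_mem (hne C hC)) ?_
    rw [h]
    exact D.min'_mem _
  · intro k hk
    simp only [leastLabels, Finset.mem_filter, Finset.mem_univ, true_and] at hk
    obtain ⟨D, hD, hk, hle⟩ := hk
    exact ⟨D, hD, le_antisymm (D.min'_le k hk) (hle _ (D.min'_mem _))⟩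

/-- Swapping the labels `i` and `j`. -/
def swap (t : LeafTree n) (i j : Fin n) : LeafTree n where
  clades := t.clades.map (Finset.mapEmbedding (Equiv.swap i j).toEmbedding).toEmbedding
  univ_mem := by
    simp only [Finset.mem_map]
    exact ⟨_, t.univ_mem, by simp⟩
  singleton_mem k := by
    simp only [Finset.mem_map]
    exact ⟨_, t.singleton_mem (Equiv.swap i j k), by simp⟩
  empty_notMem := by
    simp only [Finset.mem_map, not_exists, not_and]
    intro C hC h
    obtain rfl : C = ∅ := by simpa using h
    exact t.empty_notMem hC
  nested := by
    simp only [Finset.mem_map]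
    rintro _ ⟨C, hC, rfl⟩ _ ⟨D, hD, rfl⟩
    simpa using t.nested C hC D hD

/-- Deleting the leaf `j`, contracting its parent if that had only two children, and relabelling
the remaining leaves by the increasing bijection. On clades: the label `j` is removed from every
clade, the empty set is dropped, and coinciding clades are merged. The map `j.succAbove` is the
increasing bijection from the new labels onto the remaining old labels, so taking preimages
removes `j` and relabels. -/
def delete (t : LeafTree (n + 2)) (j : Fin (n + 2)) : LeafTree (n + 1) where
  clades := (t.clades.image fun C => Finset.univ.filter fun k => j.succAbove k ∈ C).erase ∅
  univ_mem := by
    refine Finset.mem_erase.2 ⟨Finset.univ_nonempty.ne_empty, ?_⟩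
    exact Finset.mem_image.2 ⟨_, t.univ_mem, by simp⟩
  singleton_mem k := by
    refine Finset.mem_erase.2 ⟨Finset.singleton_ne_empty k, ?_⟩
    refine Finset.mem_image.2 ⟨_, t.singleton_mem (j.succAbove k), ?_⟩
    ext l
    simp
  empty_notMem := Finset.notMem_erase _ _
  nested := by
    intro C' hC' D' hD'
    obtain ⟨C, hC, rfl⟩ := Finset.mem_image.1 (Finset.mem_of_mem_erase hC')
    obtain ⟨D, hD, rfl⟩ := Finset.mem_image.1 (Finset.mem_of_mem_erase hD')
    rcases t.nested C hC D hD with h | h | h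
    · left
      intro k
      simpa using fun hk => h hk
    · right; left
      intro k
      simpa using fun hk => h hk
    · right; right
      rw [Finset.disjoint_left] at h ⊢
      intro k
      simpa using fun hk => h hk

/-- A clade of the old tree, as a set of labels of the new one. -/
def lift (D : Finset (Fin n)) : Finset (Fin (n + 1)) := D.map Fin.castSuccEmb

lemma castSucc_mem_lift {D : Finset (Fin n)} {k : Fin n} : k.castSucc ∈ lift D ↔ k ∈ D := by
  simp [lift]

lemma last_notMem_lift {D : Finset (Fin n)} : Fin.last n ∉ lift D := by
  simp [lift, (Fin.castSucc_lt_last _).ne]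

/-- Attaching a new largest leaf to a tree, where `P D` says that the vertex `D` will lie below
the new leaf, and `Q D` says that the vertex `D` will also be (or stay) a vertex without the new
leaf above it. The conditions ensure that the outcome is a tree. -/
def attach (t : LeafTree n) (P Q : Finset (Fin n) → Prop) (hP : P Finset.univ)
    (hQ : ∀ k, Q {k})
    (hPQ : ∀ D ∈ t.clades, ∀ E ∈ t.clades, P D → Q E → E ⊆ D ∨ Disjoint D E)
    (hPP : ∀ D ∈ t.clades, ∀ E ∈ t.clades, P D → P E → D ⊆ E ∨ E ⊆ D) :
    LeafTree (n + 1) where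
  clades := by
    classical
    exact (t.clades.filter P).image (fun D => insert (Fin.last n) (lift D)) ∪
      (t.clades.filter Q).image lift ∪ {{Fin.last n}}
  univ_mem := by
    classical
    refine Finset.mem_union_left _ (Finset.mem_union_left _ (Finset.mem_image.2
      ⟨Finset.univ, Finset.mem_filter.2 ⟨t.univ_mem, hP⟩, ?_⟩))
    ext k
    induction k using Fin.lastCases <;> simp [castSucc_mem_lift]
  singleton_mem k := by
    classical
    induction k using Fin.lastCases with
    | last => simp
    | cast k =>
      refine Finset.mem_union_left _ (Finset.mem_union_right _ (Finset.mem_image.2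
        ⟨{k}, Finset.mem_filter.2 ⟨t.singleton_mem k, hQ k⟩, ?_⟩))
      simp [lift]
  empty_notMem := by
    classical
    simp only [Finset.mem_union, Finset.mem_image, Finset.mem_filter, Finset.mem_singleton, lift,
      Finset.map_eq_empty, not_or, not_exists, not_and]
    refine ⟨⟨fun D _ h => Finset.insert_ne_empty _ _ h, ?_⟩, (Finset.singleton_ne_empty _).symm⟩
    rintro D ⟨hD, _⟩ rfl
    exact t.empty_notMem hD
  nested := by
    classical
    have hl : ∀ {D E : Finset (Fin n)}, lift D ⊆ lift E ↔ D ⊆ E := Finset.map_subset_map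
    have hd : ∀ {D E : Finset (Fin n)}, Disjoint (lift D) (lift E) ↔ Disjoint D E :=
      Finset.disjoint_map _
    have key : ∀ D ∈ t.clades, ∀ E ∈ t.clades, P D → Q E →
        lift E ⊆ insert (Fin.last n) (lift D) ∨
          Disjoint (insert (Fin.last n) (lift D)) (lift E) := by
      intro D hD E hE h h'
      rcases hPQ D hD E hE h h' with h1 | h1
      · exact Or.inl ((hl.2 h1).trans (Finset.subset_insert _ _))
      · exact Or.inr (Finset.disjoint_insert_left.2 ⟨last_notMem_lift, hd.2 h1⟩)
    intro X hX Y hY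
    simp only [Finset.mem_union, Finset.mem_image, Finset.mem_filter,
      Finset.mem_singleton] at hX hY
    rcases hX with (⟨D, ⟨hD, hPD⟩, rfl⟩ | ⟨D, ⟨hD, hQD⟩, rfl⟩) | rfl <;>
    rcases hY with (⟨E, ⟨hE, hPE⟩, rfl⟩ | ⟨E, ⟨hE, hQE⟩, rfl⟩) | rfl
    · rcases hPP D hD E hE hPD hPE with h | h
      · exact Or.inl (Finset.insert_subset_insert _ (hl.2 h))
      · exact Or.inr (Or.inl (Finset.insert_subset_insert _ (hl.2 h)))
    · exact Or.inr (key D hD E hE hPD hQE)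
    · exact Or.inr (Or.inl (by simp))
    · rcases key E hE D hD hPE hQD with h | h
      · exact Or.inl h
      · exact Or.inr (Or.inr h.symm)
    · simpa [hl, hd] using t.nested D hD E hE
    · exact Or.inr (Or.inr (Finset.disjoint_singleton_right.2 last_notMem_lift))
    · exact Or.inl (by simp)
    · exact Or.inr (Or.inr (Finset.disjoint_singleton_left.2 last_notMem_lift))
    · exact Or.inl subset_rfl

lemma subset_or_subset (t : LeafTree n) {C D E : Finset (Fin n)} (hC : C ∈ t.clades)
    (hD : D ∈ t.clades) (hE : E ∈ t.clades) (h : C ⊆ D) (h' : C ⊆ E) : D ⊆ E ∨ E ⊆ D := by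
  rcases t.nested D hD E hE with h1 | h1 | h1
  · exact Or.inl h1
  · exact Or.inr h1
  · obtain ⟨k, hk⟩ := t.nonempty_of_mem hC
    exact absurd (h' hk) (Finset.disjoint_left.1 h1 (h hk))

/-- Inserting a new leaf, with the next label, into the edge between the vertex `C` and its
parent: `C ∪ {new leaf}` becomes the new branch point on that edge, the new leaf is added to all
vertices strictly below `C`, and all other vertices (including `C`) stay as they are. -/
def insertEdge (t : LeafTree n) (C : Finset (Fin n)) (hC : C ∈ t.clades) : LeafTree (n + 1) :=
  t.attach (fun D => C ⊆ D) (fun D => ¬ C ⊂ D) (Finset.subset_univ _)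
    (fun k h => (t.nonempty_of_mem hC).ne_empty (Finset.ssubset_singleton_iff.1 h))
    (by
      intro D hD E hE h h'
      rcases t.nested D hD E hE with h1 | h1 | h1
      · by_cases hCE : C = E
        · exact Or.inl (hCE ▸ h)
        · exact absurd ((h.trans h1).ssubset_of_ne hCE) h'
      · exact Or.inl h1
      · exact Or.inr h1)
    (fun _ hD _ hE h h' => t.subset_or_subset hC hD hE h h')

/-- Inserting a new leaf, with the next label, into the branch point `v`: the new leaf is a new
child of `v`, so it is added to `v` and to all vertices below `v`. -/
def insertBranchPoint (t : LeafTree n) (v : Finset (Fin n)) (hv : v ∈ t.branchPoints) :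
    LeafTree (n + 1) :=
  t.attach (fun D => v ⊆ D) (fun D => ¬ v ⊆ D) (Finset.subset_univ _)
    (fun k h => by
      have h1 := Finset.card_le_card h
      have h2 := (Finset.mem_filter.1 hv).2
      simp at h1
      omega)
    (by
      intro D hD E hE h h'
      rcases t.nested D hD E hE with h1 | h1 | h1
      · exact absurd (h.trans h1) h'
      · exact Or.inl h1
      · exact Or.inr h1)
    (fun _ hD _ hE h h' => t.subset_or_subset (Finset.mem_filter.1 hv).1 hD hE h h')

/-- The insertable parts of a tree: its edges (an edge is named by its endpoint further away from
the root) and its branch points. -/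
abbrev InsertablePart (t : LeafTree n) : Type :=
  {C : Finset (Fin n) // C ∈ t.clades} ⊕ {v : Finset (Fin n) // v ∈ t.branchPoints}

/-- Inserting a new leaf, with the next label, into an insertable part. -/
def insertLeaf (t : LeafTree n) : t.InsertablePart → LeafTree (n + 1)
  | .inl C => t.insertEdge C.1 C.2
  | .inr v => t.insertBranchPoint v.1 v.2

/-- The weight of an insertable part: `1 - α` for an external edge, `γ` for an internal edge,
`(c_v - 1) α - γ` for a branch point `v` with `c_v` children. The edge at the root is internal if
there are at least two leaves, and external if it is the edge of the only leaf. -/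
def weight (α γ : ℝ) (t : LeafTree n) : t.InsertablePart → ℝ
  | .inl C => if C.1.card = 1 then 1 - α else γ
  | .inr v => ((t.numChildren v.1 : ℝ) - 1) * α - γ

lemma exists_parent (t : LeafTree n) {D : Finset (Fin n)} (hD : D ∈ t.clades)
    (hne : D ≠ Finset.univ) : ∃ v ∈ t.branchPoints, D ∈ t.children v := by
  obtain ⟨v, hv⟩ := (t.clades.filter fun E => D ⊂ E).exists_minimal
    ⟨Finset.univ, Finset.mem_filter.2 ⟨t.univ_mem, (Finset.subset_univ D).ssubset_of_ne hne⟩⟩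
  have hv1 := Finset.mem_filter.1 hv.1
  refine ⟨v, Finset.mem_filter.2 ⟨hv1.1, ?_⟩, Finset.mem_filter.2 ⟨hD, hv1.2, ?_⟩⟩
  · have h1 := Finset.card_lt_card hv1.2
    have h2 := (t.nonempty_of_mem hD).card_pos
    omega
  · intro E hE hDE hEv
    exact hEv.2 (hv.2 (Finset.mem_filter.2 ⟨hE, hDE⟩) hEv.1)

lemma sum_numChildren (t : LeafTree n) :
    ∑ v ∈ t.branchPoints, t.numChildren v + 1 = t.clades.card := by
  have hU : t.clades.erase Finset.univ = t.branchPoints.biUnion t.children := by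
    ext D
    simp only [Finset.mem_erase, Finset.mem_biUnion]
    constructor
    · rintro ⟨hne, hD⟩
      exact t.exists_parent hD hne
    · rintro ⟨v, _, hD⟩
      have := Finset.mem_filter.1 hD
      refine ⟨?_, this.1⟩
      rintro rfl
      exact this.2.1.2 (Finset.subset_univ _)
  have hdisj : (t.branchPoints : Set (Finset (Fin n))).PairwiseDisjoint t.children := by
    intro v hv w hw hvw
    refine Finset.disjoint_left.2 fun D hDv hDw => ?_
    have hDv := Finset.mem_filter.1 hDv
    have hDw := Finset.mem_filter.1 hDw
    have hv := (Finset.mem_filter.1 hv).1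
    have hw := (Finset.mem_filter.1 hw).1
    rcases t.subset_or_subset hDv.1 hv hw hDv.2.1.1 hDw.2.1.1 with h | h
    · exact hDw.2.2 v hv hDv.2.1 (h.ssubset_of_ne hvw)
    · exact hDv.2.2 w hw hDw.2.1 (h.ssubset_of_ne hvw.symm)
  have h1 := Finset.card_biUnion hdisj
  rw [← hU, Finset.card_erase_of_mem t.univ_mem] at h1
  have h2 : 0 < t.clades.card := Finset.card_pos.2 ⟨_, t.univ_mem⟩
  simp only [numChildren]
  omega

lemma two_le_numChildren (t : LeafTree n) {v : Finset (Fin n)} (hv : v ∈ t.branchPoints) :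
    2 ≤ t.numChildren v := by
  have hv := Finset.mem_filter.1 hv
  have hch : ∀ k ∈ v, ∃ D ∈ t.children v, k ∈ D := by
    intro k hk
    obtain ⟨D, hD⟩ := (t.clades.filter fun E => k ∈ E ∧ E ⊂ v).exists_maximal
      ⟨{k}, Finset.mem_filter.2 ⟨t.singleton_mem k, by simp,
        (Finset.singleton_subset_iff.2 hk).ssubset_of_ne (by
          rintro rfl
          simp at hv)⟩⟩
    have hD1 := Finset.mem_filter.1 hD.1
    refine ⟨D, Finset.mem_filter.2 ⟨hD1.1, hD1.2.2, ?_⟩, hD1.2.1⟩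
    intro E hE hDE hEv
    exact hDE.2 (hD.2 (Finset.mem_filter.2 ⟨hE, hDE.1 hD1.2.1, hEv⟩) hDE.1)
  obtain ⟨k, hk⟩ := t.nonempty_of_mem hv.1
  obtain ⟨D, hD, -⟩ := hch k hk
  obtain ⟨l, hl, hlD⟩ := Finset.exists_of_ssubset (Finset.mem_filter.1 hD).2.1
  obtain ⟨E, hE, hlE⟩ := hch l hl
  have : 1 < (t.children v).card :=
    Finset.one_lt_card.2 ⟨D, hD, E, hE, fun h => hlD (h ▸ hlE)⟩
  exact this

lemma card_clades (t : LeafTree n) : t.clades.card = n + t.branchPoints.card := by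
  have h1 : (t.clades.filter fun C => ¬ 2 ≤ C.card) =
      Finset.univ.map ⟨fun k : Fin n => ({k} : Finset (Fin n)), Finset.singleton_injective⟩ := by
    ext C
    simp only [Finset.mem_filter, Finset.mem_map, Finset.mem_univ, true_and,
      Function.Embedding.coeFn_mk]
    constructor
    · rintro ⟨hC, h⟩
      have := (t.nonempty_of_mem hC).card_pos
      obtain ⟨k, hk⟩ := Finset.card_eq_one.1 (show C.card = 1 by omega)
      exact ⟨k, hk.symm⟩
    · rintro ⟨k, rfl⟩
      exact ⟨t.singleton_mem k, by simp⟩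
  have h2 := Finset.card_filter_add_card_filter_not (s := t.clades) (fun C => 2 ≤ C.card)
  rw [h1] at h2
  simp only [Finset.card_map, Finset.card_univ, Fintype.card_fin] at h2
  simp only [branchPoints]
  omega

/-- The total weight of a tree with `n` leaves is `n - α`. -/
lemma sum_weight (α γ : ℝ) (t : LeafTree n) : ∑ x, t.weight α γ x = n - α := by
  have hE : ∑ C : {C // C ∈ t.clades}, (if C.1.card = 1 then 1 - α else γ) =
      ∑ C ∈ t.clades, (if C.card = 1 then 1 - α else γ) :=
    Finset.sum_coe_sort t.clades (fun C => if C.card = 1 then 1 - α else γ)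
  have hB : ∑ v : {v // v ∈ t.branchPoints}, (((t.numChildren v.1 : ℝ) - 1) * α - γ) =
      ∑ v ∈ t.branchPoints, (((t.numChildren v : ℝ) - 1) * α - γ) :=
    Finset.sum_coe_sort t.branchPoints (fun v => ((t.numChildren v : ℝ) - 1) * α - γ)
  rw [Fintype.sum_sum_type]
  simp only [weight]
  rw [hE, hB]
  have h1 : ∑ C ∈ t.clades, (if C.card = 1 then 1 - α else γ) =
      ∑ C ∈ t.clades, (if 2 ≤ C.card then γ else 1 - α) := by
    refine Finset.sum_congr rfl fun C hC => ?_
    have := (t.nonempty_of_mem hC).card_pos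
    by_cases h : C.card = 1
    · simp [h]
    · rw [if_neg h, if_pos (by omega)]
  have hc := t.card_clades
  have h2 := Finset.card_filter_add_card_filter_not (s := t.clades) (fun C => 2 ≤ C.card)
  have h3 : (t.clades.filter fun C => 2 ≤ C.card).card = t.branchPoints.card := rfl
  have h4 : (t.clades.filter fun C => ¬ 2 ≤ C.card).card = n := by omega
  have hs : (∑ v ∈ t.branchPoints, (t.numChildren v : ℝ)) + 1 = n + t.branchPoints.card := by
    have h := t.sum_numChildren
    rw [hc] at h
    exact_mod_cast h
  rw [h1, Finset.sum_ite, Finset.sum_const, Finset.sum_const, h3, h4, Finset.sum_sub_distrib,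
    ← Finset.sum_mul, Finset.sum_sub_distrib, Finset.sum_const, Finset.sum_const]
  simp only [nsmul_eq_mul, mul_one]
  linear_combination α * hs

end LeafTree

/-- The parameter range `0 ≤ γ ≤ α ≤ 1`. -/
def Admissible (α γ : ℝ) : Prop := 0 ≤ γ ∧ γ ≤ α ∧ α ≤ 1

namespace LeafTree

variable {n : ℕ}

lemma weight_nonneg {α γ : ℝ} (h : Admissible α γ) (t : LeafTree n) (x : t.InsertablePart) :
    0 ≤ t.weight α γ x := by
  obtain ⟨h0, h1, h2⟩ := h
  rcases x with C | v
  · simp only [weight]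
    split_ifs <;> linarith
  · simp only [weight]
    have h3 : (2 : ℝ) ≤ t.numChildren v.1 := by exact_mod_cast t.two_le_numChildren v.2
    nlinarith

/-- The probability of picking the insertable part `x` of a tree with `n + 1` leaves:
the weight divided by the total weight `(n + 1) - α`. A tree with a single leaf has a single
insertable part, which is picked with probability one (for `α < 1` this is `(1 - α) / (1 - α)`). -/
def insertProb (α γ : ℝ) (t : LeafTree (n + 1)) (x : t.InsertablePart) : ℝ :=
  if n = 0 then 1 else t.weight α γ x / ((n + 1 : ℕ) - α)

lemma sum_insertProb {α γ : ℝ} (h : Admissible α γ) (t : LeafTree (n + 1)) :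
    ∑ x, ENNReal.ofReal (t.insertProb α γ x) = 1 := by
  have hden : n ≠ 0 → (0 : ℝ) < (n + 1 : ℕ) - α := by
    intro hn
    have : (1 : ℝ) ≤ n := by exact_mod_cast Nat.one_le_iff_ne_zero.2 hn
    have := h.2.2
    push_cast
    linarith
  rw [← ENNReal.ofReal_sum_of_nonneg]
  · rw [ENNReal.ofReal_eq_one]
    by_cases hn : n = 0
    · subst hn
      simp only [insertProb, if_true, Finset.sum_const, Finset.card_univ, Fintype.card_sum,
        Fintype.card_coe, nsmul_eq_mul, mul_one]
      have hb : t.branchPoints = ∅ := by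
        refine Finset.filter_eq_empty_iff.2 fun C _ hC => ?_
        have := C.card_le_univ
        simp at this
        omega
      have := t.card_clades
      simp [this, hb]
    · simp only [insertProb, if_neg hn]
      rw [← Finset.sum_div, t.sum_weight, div_self (hden hn).ne']
  · intro x _
    unfold insertProb
    split_ifs with hn
    · exact zero_le_one
    · exact div_nonneg (t.weight_nonneg h x) (hden hn).le

end LeafTree

/-- The up-step: the growth rule from trees with `n + 1` to trees with `n + 2` leaves. -/
def upStep {α γ : ℝ} (h : Admissible α γ) {n : ℕ} (t : LeafTree (n + 1)) :
    PMF (LeafTree (n + 2)) :=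
  (PMF.ofFintype (fun x => ENNReal.ofReal (t.insertProb α γ x)) (t.sum_insertProb h)).map
    t.insertLeaf

/-- The unique tree with one leaf. -/
def oneLeafTree : LeafTree 1 where
  clades := {Finset.univ}
  univ_mem := by simp
  singleton_mem k := by simp [Subsingleton.elim _ k]
  empty_notMem := by simp [eq_comm (a := ∅)]
  nested := by simp

/-- The law of step `n + 1` of the growth process, the random tree with `n + 1` leaves. -/
def growthLaw {α γ : ℝ} (h : Admissible α γ) : (n : ℕ) → PMF (LeafTree (n + 1))
  | 0 => PMF.pure oneLeafTree
  | n + 1 => (growthLaw h n).bind (upStep h)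

/-- For a leaf `i_j` at a branch point with `c ≥ 3` children, the probability that the leaf
`i_{j'}` is the one picked by the local search. The common denominator is `(c - 2) α - γ`. If it
vanishes (only for `c = 3`, `α = γ`, and for `α = γ = 0`) then `j' = 3` is picked for `j ≤ 2`, and
`j' = j` for `j ≥ 3`. -/
def searchProb (α γ : ℝ) (c j j' : ℕ) : ℝ :=
  if ((c : ℝ) - 2) * α - γ = 0 then
    (if j' = max j 3 then 1 else 0)
  else if j ≤ 2 then
    (if j' = 3 then (α - γ) / (((c : ℝ) - 2) * α - γ)
      else if 3 < j' then α / (((c : ℝ) - 2) * α - γ)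
      else 0)
  else
    (if j' = j then (((j : ℝ) - 2) * α - γ) / (((c : ℝ) - 2) * α - γ)
      else if j < j' then α / (((c : ℝ) - 2) * α - γ)
      else 0)

lemma searchProb_nonneg {α γ : ℝ} (h : Admissible α γ) {c : ℕ} (hc : 3 ≤ c) (j j' : ℕ) :
    0 ≤ searchProb α γ c j j' := by
  obtain ⟨h0, h1, h2⟩ := h
  have hc' : (3 : ℝ) ≤ c := by exact_mod_cast hc
  have hα : 0 ≤ α := h0.trans h1
  have hD : 0 ≤ ((c : ℝ) - 2) * α - γ := by nlinarith
  unfold searchProb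
  by_cases hD0 : ((c : ℝ) - 2) * α - γ = 0
  · rw [if_pos hD0]
    split_ifs <;> simp
  rw [if_neg hD0]
  by_cases hj : j ≤ 2
  · rw [if_pos hj]
    split_ifs
    · exact div_nonneg (by linarith) hD
    · exact div_nonneg hα hD
    · exact le_rfl
  · rw [if_neg hj]
    have hj' : (3 : ℝ) ≤ j := by exact_mod_cast (show 3 ≤ j by omega)
    split_ifs
    · exact div_nonneg (by nlinarith) hD
    · exact div_nonneg hα hD
    · exact le_rfl

lemma sum_searchNumerator (x y : ℝ) {m c : ℕ} (hm : 1 ≤ m) (hc : m ≤ c) :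
    ∑ k ∈ Finset.range c, (if k + 1 = m then x else if m < k + 1 then y else 0) =
      x + ((c : ℝ) - m) * y := by
  induction c, hc using Nat.le_induction with
  | base =>
    obtain ⟨m, rfl⟩ : ∃ l, m = l + 1 := ⟨m - 1, by omega⟩
    rw [Finset.sum_range_succ, Finset.sum_eq_zero]
    · simp
    · intro k hk
      have := Finset.mem_range.1 hk
      rw [if_neg (by omega), if_neg (by omega)]
  | succ c hc ih =>
    rw [Finset.sum_range_succ, ih, if_neg (by omega), if_pos (by omega)]
    push_cast
    ring

lemma sum_searchProb {α γ : ℝ} (h : Admissible α γ) {c j : ℕ} (hc : 3 ≤ c) (hj : j ≤ c) :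
    ∑ k : Fin c, ENNReal.ofReal (searchProb α γ c j (k.1 + 1)) = 1 := by
  rw [← ENNReal.ofReal_sum_of_nonneg fun _ _ => searchProb_nonneg h hc _ _,
    ENNReal.ofReal_eq_one, Fin.sum_univ_eq_sum_range (fun k => searchProb α γ c j (k + 1)) c]
  by_cases hD : ((c : ℝ) - 2) * α - γ = 0
  · have := sum_searchNumerator 1 0 (m := max j 3) (c := c) (by omega) (by omega)
    simp only [searchProb, if_pos hD]
    simpa using this
  · by_cases hj2 : j ≤ 2
    · simp only [searchProb, if_neg hD, if_pos hj2]
      rw [sum_searchNumerator _ _ (by omega) hc]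
      rw [← mul_div_assoc, ← add_div, div_eq_one_iff_eq hD]
      push_cast
      ring
    · simp only [searchProb, if_neg hD, if_neg hj2]
      rw [sum_searchNumerator _ _ (by omega) hj]
      rw [← mul_div_assoc, ← add_div, div_eq_one_iff_eq hD]
      ring

/-- The smallest label in `S`, and the smallest possible label if `S` is empty (which then does
not contribute to a maximum). -/
def leastLabel {n : ℕ} (S : Finset (Fin (n + 1))) : Fin (n + 1) :=
  if hS : S.Nonempty then S.min' hS else 0

/-- The conditional law, given the tree and the selected leaf `i`, of the leaf found by the local
search. Here `v` is the parent of `i`. If `v` has two children, it is the maximum of `i`, the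
smallest label `a` in the first spinal bush (above `v`, away from `i`), and the smallest label `b`
in the second spinal bush (above the parent of `v`, away from `v`), if there is one. If `v` has
`c ≥ 3` children, with smallest labels `i_1 < … < i_c` in the subtrees of `v`, and `i = i_j`, it
is `i_{j'}` with probability `searchProb α γ c j j'`. -/
def searchLaw {α γ : ℝ} (h : Admissible α γ) {n : ℕ} (t : LeafTree (n + 2)) (i : Fin (n + 2)) :
    PMF (Fin (n + 2)) :=
  let v := t.parent {i}
  if hc : 3 ≤ t.numChildren v then
    (PMF.ofFintype
      (fun k : Fin (t.numChildren v) => ENNReal.ofReal (searchProb α γ (t.numChildren v)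
        ((t.leastLabels v).filter fun l => l ≤ i).card (k.1 + 1)))
      (sum_searchProb h hc
        ((Finset.card_filter_le _ _).trans (t.card_leastLabels v).le))).map
      ((t.leastLabels v).orderEmbOfFin (t.card_leastLabels v))
  else
    PMF.pure (max i (max (leastLabel (v \ {i})) (leastLabel (t.parent v \ v))))

/-- The down-step: select a leaf `i` uniformly at random, find a leaf by the local search,
swap the two labels, delete the leaf now carrying the label found, and relabel increasingly. -/
def downStep {α γ : ℝ} (h : Admissible α γ) {n : ℕ} (t : LeafTree (n + 2)) :
    PMF (LeafTree (n + 1)) :=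
  (PMF.uniformOfFintype (Fin (n + 2))).bind fun i =>
    (searchLaw h t i).map fun j => (t.swap i j).delete j

/-- The transition kernel of the down-up chain on trees with `n + 1` leaves. There is only one
tree with one leaf, so that for `n = 0` the chain does not move. -/
def chainKernel {α γ : ℝ} (h : Admissible α γ) :
    (n : ℕ) → LeafTree (n + 1) → PMF (LeafTree (n + 1))
  | 0, t => PMF.pure t
  | _ + 1, t => (downStep h t).bind (upStep h)

/-- `X` is a Markov chain (in discrete time, on a discrete state space) with initial law `μ` and
transition kernel `K`. -/
structure IsMarkovChain {Ω S : Type*} [MeasurableSpace Ω] [MeasurableSpace S] (P : Measure Ω)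
    (X : ℕ → Ω → S) (μ : PMF S) (K : S → PMF S) : Prop where
  measurable : ∀ m, Measurable (X m)
  initial : ∀ s, P {ω | X 0 ω = s} = μ s
  transition : ∀ (m : ℕ) (s : ℕ → S),
    P {ω | ∀ k ≤ m + 1, X k ω = s k} = P {ω | ∀ k ≤ m, X k ω = s k} * K (s m) (s (m + 1))

/-- The process `X` is stationary: time shifts do not change its law on the space of paths. -/
def IsStationary {Ω S : Type*} [MeasurableSpace Ω] [MeasurableSpace S] (P : Measure Ω)
    (X : ℕ → Ω → S) : Prop :=
  ∀ r : ℕ, P.map (fun ω (m : ℕ) => X (m + r) ω) = P.map (fun ω (m : ℕ) => X m ω)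

end AlphaGamma

end

open MeasureTheory
open scoped ENNReal

noncomputable section

namespace AlphaGamma

/-! ### Expectations under probability mass functions -/

/-! The heart of the matter is stronger than invariance: for every fixed label `i`, the down-step
that starts its search at leaf `i` sends the law of the growth process to its law with one leaf
fewer (`growthLaw_bind_downStepFrom`). Averaging over a uniform `i` and applying the growth step
gives the invariant law of the chain, and stationarity on path space follows by general Markov chain
arguments.

The fixed-label claim is an induction on the number of leaves. If `i` is the newest leaf, the search
finds `i` itself, and deleting it undoes the last insertion (`upStep_bind_downStepFrom_last`). If
`i` is older, let `U` be the growth step, `D_i` the down-step from `i`, and let `t` have `N` leaves.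
The relation needed is `(N - α) U D_i f (t) = f t + (N - 1 - α) D_i U f (t)`
(`expect_upStep_downStepFrom`). Integrating it against the growth law and using the induction
hypothesis on the right gives `1 + (N - 1 - α) = N - α` times the integral of `f`.

The relation comes from splitting the weight of each insertable part
(`weight_mul_expect_searchLaw`). Part of the weight near `i` makes the search find the new leaf;
swapping and deleting then restores `t`, and this weight has total `1` (`sum_nearWeight`). If the
parent of `i` has two children, it consists of `1 - α` at the edge of `i`, `γ` at the edge below the
parent and `α - γ` at the parent; otherwise of `1 - α` at the edge of `i` and `α` at the parent. For
the remaining weight the search finds an old leaf with the same conditional law as before the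
insertion. Deletion then commutes with insertion (`IsRestriction.eq_insertLeaf`), and the remaining
weight equals the weight in the reduced tree (`IsRestriction.weight_part`). At a parent with at
least three children this rests on the unnormalised search weights not depending on the number of
children (`mul_searchProb_succ`). -/

/-- The expectation of a nonnegative function under a probability mass function. -/
def expect {A : Type*} (p : PMF A) (f : A → ℝ≥0∞) : ℝ≥0∞ := ∑' a, p a * f a

section Expect

variable {A B : Type*}

lemma expect_pure (a : A) (f : A → ℝ≥0∞) : expect (PMF.pure a) f = f a := by
  classical
  unfold expect
  rw [tsum_eq_single a]
  · simp
  · intro b hb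
    simp [hb]

lemma expect_bind (p : PMF A) (K : A → PMF B) (f : B → ℝ≥0∞) :
    expect (p.bind K) f = expect p fun a => expect (K a) f := by
  simp only [expect, PMF.bind_apply, ← ENNReal.tsum_mul_right, ← ENNReal.tsum_mul_left]
  rw [ENNReal.tsum_comm]
  simp only [mul_assoc]

lemma expect_map (p : PMF A) (g : A → B) (f : B → ℝ≥0∞) :
    expect (p.map g) f = expect p fun a => f (g a) := by
  simp only [PMF.map, expect_bind, Function.comp_apply, expect_pure]

lemma expect_ofFintype [Fintype A] (w : A → ℝ≥0∞) (hw : ∑ a, w a = 1) (f : A → ℝ≥0∞) :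
    expect (PMF.ofFintype w hw) f = ∑ a, w a * f a := by
  simp [expect, tsum_fintype]

lemma expect_fintype [Fintype A] (p : PMF A) (f : A → ℝ≥0∞) :
    expect p f = ∑ a, p a * f a := by
  simp [expect, tsum_fintype]

lemma expect_add (p : PMF A) (f g : A → ℝ≥0∞) :
    expect p (fun a => f a + g a) = expect p f + expect p g := by
  simp only [expect, mul_add, ENNReal.tsum_add]

lemma expect_mul_left (p : PMF A) (c : ℝ≥0∞) (f : A → ℝ≥0∞) :
    expect p (fun a => c * f a) = c * expect p f := by
  simp only [expect, ← ENNReal.tsum_mul_left]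
  exact tsum_congr fun a => by ring

lemma expect_const (p : PMF A) (c : ℝ≥0∞) : expect p (fun _ => c) = c := by
  simp only [expect, ENNReal.tsum_mul_right, p.tsum_coe, one_mul]

lemma pmf_ext_of_expect {p q : PMF A} (h : ∀ f, expect p f = expect q f) : p = q := by
  classical
  ext a
  have key : ∀ r : PMF A, expect r (fun b => if b = a then 1 else 0) = r a := by
    intro r
    unfold expect
    rw [tsum_eq_single a]
    · simp
    · intro b hb
      simp [hb]
  rw [← key p, ← key q, h]

end Expect

/-! ### Markov chains started from an invariant law -/

section Markov

variable {Ω S : Type*} [MeasurableSpace Ω] [MeasurableSpace S] {P : Measure Ω} {X : ℕ → Ω → S} {μ : PMF S} {K : S → PMF S}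

lemma measurableSet_path [MeasurableSingletonClass S] (hX : ∀ m, Measurable (X m)) (m : ℕ) (s : ℕ → S) :
    MeasurableSet {ω | ∀ k ≤ m, X k ω = s k} := by
  have : {ω | ∀ k ≤ m, X k ω = s k} = ⋂ k, ⋂ (_ : k ≤ m), X k ⁻¹' {s k} := by
    ext ω
    simp
  rw [this]
  exact MeasurableSet.iInter fun k => MeasurableSet.iInter fun _ =>
    hX k (measurableSet_singleton _)

/-- Splitting according to the value of `X 0` turns an event about the shifted path into a countable
disjoint union of events about the original one. This makes the one-step shift accessible to
`transition`. -/
lemma IsMarkovChain.measure_path_shift [Countable S] [MeasurableSingletonClass S]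
    (h : IsMarkovChain P X μ K) (m : ℕ) (s : ℕ → S) :
    P {ω | ∀ k ≤ m, X (k + 1) ω = s k} =
      ∑' a, P {ω | ∀ k ≤ m + 1, X k ω = (fun k => Nat.casesOn k a s : ℕ → S) k} := by
  rw [← measure_iUnion]
  · congr 1
    ext ω
    simp only [Set.mem_ofPred_eq, Set.mem_iUnion]
    constructor
    · intro hω
      refine ⟨X 0 ω, fun k hk => ?_⟩
      cases k with
      | zero => rfl
      | succ k => exact hω k (by omega)
    · rintro ⟨a, ha⟩ k hk
      exact ha (k + 1) (by omega)
  · intro a b hab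
    refine Set.disjoint_left.2 fun ω ha hb => hab ?_
    exact (ha 0 (Nat.zero_le _)).symm.trans (hb 0 (Nat.zero_le _))
  · exact fun a => measurableSet_path h.measurable _ _

/-- Invariance of `μ` enters only through the initial law; the transition property of the shifted
process follows by summing the original one over the forgotten first state. -/
lemma IsMarkovChain.shift [Countable S] [MeasurableSingletonClass S]
    (h : IsMarkovChain P X μ K) (hμ : μ.bind K = μ) :
    IsMarkovChain P (fun m => X (m + 1)) μ K where
  measurable m := h.measurable (m + 1)
  initial s := by
    have h1 := h.measure_path_shift 0 (fun _ => s)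
    have h2 : {ω | ∀ k ≤ 0, X (k + 1) ω = s} = {ω | X (0 + 1) ω = s} := by
      ext ω
      simp
    rw [← h2, h1]
    conv_rhs => rw [← hμ, PMF.bind_apply]
    refine tsum_congr fun a => ?_
    rw [h.transition]
    have h3 : {ω | ∀ k ≤ 0, X k ω = (fun k => Nat.casesOn k a fun _ => s : ℕ → S) k} =
        {ω | X 0 ω = a} := by
      ext ω
      simp
    rw [h3, h.initial]
    rfl
  transition m s := by
    rw [h.measure_path_shift, h.measure_path_shift, ← ENNReal.tsum_mul_right]
    exact tsum_congr fun a => h.transition (m + 1) _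

lemma IsMarkovChain.shift_add [Countable S] [MeasurableSingletonClass S]
    (h : IsMarkovChain P X μ K) (hμ : μ.bind K = μ) (r : ℕ) :
    IsMarkovChain P (fun m => X (m + r)) μ K := by
  induction r with
  | zero => exact h
  | succ r ih =>
    have := ih.shift hμ
    simpa only [add_assoc, add_comm 1 r] using this

lemma IsMarkovChain.measure_path_eq {Y : ℕ → Ω → S} (hX : IsMarkovChain P X μ K)
    (hY : IsMarkovChain P Y μ K) (m : ℕ) (s : ℕ → S) :
    P {ω | ∀ k ≤ m, X k ω = s k} = P {ω | ∀ k ≤ m, Y k ω = s k} := by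
  induction m with
  | zero => simpa using (hX.initial (s 0)).trans (hY.initial (s 0)).symm
  | succ m ih => rw [hX.transition, hY.transition, ih]

/-- Initial law and kernel determine all probabilities of initial path segments. On a countable
state space these are the laws of the finite restrictions, and a finite measure on path space is
determined by them as their projective limit. -/
lemma IsMarkovChain.map_eq [Countable S] [MeasurableSingletonClass S]
    [IsProbabilityMeasure P] {Y : ℕ → Ω → S}
    (hX : IsMarkovChain P X μ K) (hY : IsMarkovChain P Y μ K) :
    P.map (fun ω m => X m ω) = P.map (fun ω m => Y m ω) := by
  have mX : Measurable (fun ω m => X m ω) := measurable_pi_lambda _ hX.measurable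
  have mY : Measurable (fun ω m => Y m ω) := measurable_pi_lambda _ hY.measurable
  have := Measure.isProbabilityMeasure_map (μ := P) mX.aemeasurable
  have := Measure.isProbabilityMeasure_map (μ := P) mY.aemeasurable
  have key : ∀ m, (P.map (fun ω m => X m ω)).map (Preorder.frestrictLe m) =
      (P.map (fun ω m => Y m ω)).map (Preorder.frestrictLe (π := fun _ => S) m) := by
    intro m
    refine Measure.ext_of_singleton fun s => ?_
    have hm : Measurable (Preorder.frestrictLe (π := fun _ : ℕ => S) m) :=
      Preorder.measurable_frestrictLe m
    rw [Measure.map_apply hm (measurableSet_singleton _),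
      Measure.map_apply hm (measurableSet_singleton _),
      Measure.map_apply mX (hm (measurableSet_singleton _)),
      Measure.map_apply mY (hm (measurableSet_singleton _))]
    -- Path probabilities are indexed by infinite sequences, so the finite path `s` is extended
    -- constantly beyond time `m` by means of `min k m`.
    have hset : ∀ Z : ℕ → Ω → S, (fun ω m => Z m ω) ⁻¹'
        (Preorder.frestrictLe (π := fun _ : ℕ => S) m ⁻¹' {s}) =
        {ω | ∀ k ≤ m, Z k ω = (fun k => s ⟨min k m, by simp⟩) k} := by
      intro Z
      ext ω
      simp only [Set.mem_preimage, Set.mem_singleton_iff, Set.mem_ofPred_eq, funext_iff,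
        Subtype.forall, Finset.mem_Iic, Preorder.frestrictLe_apply]
      refine forall₂_congr fun k hk => ?_
      simp [hk]
    rw [hset, hset]
    exact hX.measure_path_eq hY m _
  have hproj := ProbabilityTheory.isProjectiveMeasureFamily_map_restrict (P := P)
    fun m => (hY.measurable m).aemeasurable
  have hI : ∀ I : Finset ℕ, P.map (fun ω => I.restrict fun m => Y m ω) =
      (P.map (fun ω m => Y m ω)).map I.restrict := by
    intro I
    rw [Measure.map_map (Finset.measurable_restrict I) mY]
    rfl
  have : ∀ I : Finset ℕ, IsFiniteMeasure (P.map fun ω => I.restrict fun m => Y m ω) := by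
    intro I
    rw [hI]
    infer_instance
  refine IsProjectiveLimit.unique (P := fun I : Finset ℕ =>
    P.map fun ω => I.restrict fun m => Y m ω) ?_ fun I => (hI I).symm
  refine (isProjectiveLimit_nat_iff hproj _).2 fun m => (key m).trans ?_
  exact (hI (Finset.Iic m)).symm

lemma IsMarkovChain.isStationary [Countable S] [MeasurableSingletonClass S]
    [IsProbabilityMeasure P] (h : IsMarkovChain P X μ K)
    (hμ : μ.bind K = μ) : IsStationary P X :=
  fun r => (h.shift_add hμ r).map_eq h

end Markov

namespace LeafTree

variable {n m : ℕ}

lemma clades_injective : Function.Injective (clades : LeafTree n → Finset (Finset (Fin n))) :=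
  fun _ _ h => LeafTree.ext h

instance : Finite (LeafTree n) := Finite.of_injective _ clades_injective

/-! ### The clades after an insertion -/

/-- The vertex naming an insertable part: a branch point, or the upper endpoint of an edge. -/
def vertex (t : LeafTree n) : t.InsertablePart → Finset (Fin n)
  | .inl C => C.1
  | .inr v => v.1

lemma vertex_inl (t : LeafTree n) (C : {C // C ∈ t.clades}) :
    t.vertex (.inl C) = C.1 := rfl

lemma vertex_inr (t : LeafTree n) (v : {v // v ∈ t.branchPoints}) :
    t.vertex (.inr v) = v.1 := rfl

/-- The vertex `D` stays a vertex, without the new leaf above it, if a leaf is inserted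
into `x`. -/
def Stays (t : LeafTree n) (x : t.InsertablePart) (D : Finset (Fin n)) : Prop :=
  ¬ t.vertex x ⊆ D ∨ x.isLeft = true ∧ D = t.vertex x

lemma vertex_mem (t : LeafTree n) (x : t.InsertablePart) : t.vertex x ∈ t.clades := by
  rcases x with C | v
  · exact C.2
  · exact (Finset.mem_filter.1 v.2).1

/-- Edge and branch point insertions differ only in whether the vertex of `x` also survives without
the new leaf. With this isolated in `Stays`, later arguments treat both kinds at once. -/
lemma mem_insertLeaf (t : LeafTree n) (x : t.InsertablePart) (F : Finset (Fin (n + 1))) :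
    F ∈ (t.insertLeaf x).clades ↔
      (∃ D ∈ t.clades, t.vertex x ⊆ D ∧ insert (Fin.last n) (lift D) = F) ∨
      (∃ D ∈ t.clades, t.Stays x D ∧ lift D = F) ∨ F = {Fin.last n} := by
  have hs : ∀ C D : Finset (Fin n), ¬ C ⊂ D ↔ ¬ C ⊆ D ∨ D = C := by
    intro C D
    rw [Finset.ssubset_iff_subset_ne]
    constructor
    · intro h
      by_cases h1 : C ⊆ D
      · exact Or.inr (by_contra fun h2 => h ⟨h1, fun h3 => h2 h3.symm⟩)
      · exact Or.inl h1
    · rintro (h | rfl) ⟨h1, h2⟩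
      · exact h h1
      · exact h2 rfl
  rcases x with C | v
  · simp [insertLeaf, insertEdge, attach, vertex, Stays, hs, and_assoc]
    exact or_comm.trans or_assoc
  · simp [insertLeaf, insertBranchPoint, attach, vertex, Stays, and_assoc]
    exact or_comm.trans or_assoc

/-! ### Restricting a tree to the leaves other than a given one -/

/-- The preimage of a clade under a relabelling. -/
def pre (ρ : Fin n → Fin m) (C : Finset (Fin m)) : Finset (Fin n) :=
  Finset.univ.filter fun k => ρ k ∈ C

@[simp] lemma mem_pre {ρ : Fin n → Fin m} {C : Finset (Fin m)} {k : Fin n} :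
    k ∈ pre ρ C ↔ ρ k ∈ C := by simp [pre]

/-- The tree `D` arises from `t` by deleting leaf `i`, where leaf `k` of `D` is leaf `ρ k`
of `t`. -/
structure IsRestriction (t : LeafTree m) (i : Fin m) (ρ : Fin n → Fin m) (D : LeafTree n) :
    Prop where
  inj : Function.Injective ρ
  range : ∀ k, k ≠ i ↔ ∃ l, ρ l = k
  mem_clades : ∀ E, E ∈ D.clades ↔ E.Nonempty ∧ ∃ C ∈ t.clades, pre ρ C = E

/-- The relabelling associated with swapping `i` and `j` and then deleting `j`. -/
def swapDelete (i j : Fin (n + 1)) (k : Fin n) : Fin (n + 1) := Equiv.swap i j (j.succAbove k)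

lemma isRestriction_swap_delete (t : LeafTree (n + 2)) (i j : Fin (n + 2)) :
    IsRestriction t i (swapDelete i j) ((t.swap i j).delete j) where
  inj := (Equiv.swap i j).injective.comp Fin.succAbove_right_injective
  range k := by
    simp only [swapDelete, Equiv.swap_apply_eq_iff, Fin.exists_succAbove_eq_iff]
    rw [not_iff_not, Equiv.swap_apply_eq_iff, Equiv.swap_apply_right]
  mem_clades E := by
    simp only [delete, swap, Finset.mem_erase, Finset.mem_image, Finset.mem_map,
      exists_exists_and_eq_and, Finset.nonempty_iff_ne_empty]
    refine and_congr Iff.rfl (exists_congr fun C => and_congr Iff.rfl ?_)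
    have : pre (swapDelete i j) C = Finset.univ.filter fun k => j.succAbove k ∈
        (Finset.mapEmbedding (Equiv.swap i j).toEmbedding).toEmbedding C := by
      ext k
      simp [swapDelete, Finset.mapEmbedding_apply, Finset.mem_map_equiv]
    rw [this]

/-- A vertex is far from leaf `i` if it is neither leaf `i` nor its parent, in case this vanishes
when leaf `i` is deleted. -/
def Far (t : LeafTree n) (i : Fin n) (C : Finset (Fin n)) : Prop :=
  C ≠ {i} ∧ ¬ (i ∈ C ∧ C.erase i ∈ t.clades)

namespace IsRestriction

variable {t : LeafTree m} {i : Fin m} {ρ : Fin n → Fin m} {D : LeafTree n}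

/-- The range of `ρ` is everything except `i`, so taking preimages forgets the element `i` and
nothing else. -/
lemma pre_subset_pre (h : IsRestriction t i ρ D) {C E : Finset (Fin m)} :
    pre ρ C ⊆ pre ρ E ↔ C.erase i ⊆ E := by
  constructor
  · intro hCE k hk
    obtain ⟨l, rfl⟩ := (h.range k).1 (Finset.ne_of_mem_erase hk)
    exact mem_pre.1 (hCE (mem_pre.2 (Finset.mem_of_mem_erase hk)))
  · intro hCE k hk
    exact mem_pre.2 (hCE (Finset.mem_erase.2 ⟨(h.range _).2 ⟨k, rfl⟩, mem_pre.1 hk⟩))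

lemma card_pre (h : IsRestriction t i ρ D) (C : Finset (Fin m)) :
    (pre ρ C).card = (C.erase i).card := by
  rw [← Finset.card_map ⟨ρ, h.inj⟩]
  congr 1
  ext k
  simp only [Finset.mem_map, mem_pre, Function.Embedding.coeFn_mk, Finset.mem_erase]
  constructor
  · rintro ⟨l, hl, rfl⟩
    exact ⟨(h.range _).2 ⟨l, rfl⟩, hl⟩
  · rintro ⟨hk, hC⟩
    obtain ⟨l, rfl⟩ := (h.range k).1 hk
    exact ⟨l, hC, rfl⟩

lemma pre_nonempty (h : IsRestriction t i ρ D) {C : Finset (Fin m)} (hC : C ∈ t.clades) :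
    (pre ρ C).Nonempty ↔ C ≠ {i} := by
  rw [← Finset.card_pos, h.card_pre, Finset.card_pos, Finset.nonempty_iff_ne_empty, Ne,
    Finset.erase_eq_empty_iff, not_or]
  exact and_iff_right (t.nonempty_of_mem hC).ne_empty

lemma pre_mem (h : IsRestriction t i ρ D) {C : Finset (Fin m)} (hC : C ∈ t.clades)
    (hi : C ≠ {i}) : pre ρ C ∈ D.clades :=
  (h.mem_clades _).2 ⟨(h.pre_nonempty hC).2 hi, C, hC, rfl⟩

/-- Only the label `i` could obstruct the inclusion. If `i` lies in `C` but not in `E`, nestedness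
leaves `E = C.erase i`, which `Far` excludes, or disjointness, which is impossible since `C` has
another leaf. Hence the order on far vertices can be read off after the deletion. -/
lemma subset_of_pre (h : IsRestriction t i ρ D) {C E : Finset (Fin m)} (hC : C ∈ t.clades)
    (hfar : t.Far i C) (hE : E ∈ t.clades) (hCE : pre ρ C ⊆ pre ρ E) : C ⊆ E := by
  rw [h.pre_subset_pre] at hCE
  by_cases hiC : i ∈ C
  · by_cases hiE : i ∈ E
    · rw [← Finset.insert_erase hiC]
      exact Finset.insert_subset hiE hCE
    · rcases t.nested C hC E hE with h1 | h1 | h1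
      · exact h1
      · have : C.erase i = E := hCE.antisymm (Finset.subset_erase.2 ⟨h1, hiE⟩)
        exact absurd ⟨hiC, this ▸ hE⟩ hfar.2
      · exfalso
        obtain ⟨l, hl⟩ := (h.pre_nonempty hC).2 hfar.1
        have hl' := Finset.mem_erase.2 ⟨(h.range _).2 ⟨l, rfl⟩, mem_pre.1 hl⟩
        exact Finset.disjoint_left.1 h1 (Finset.mem_of_mem_erase hl') (hCE hl')
  · rwa [Finset.erase_eq_of_notMem hiC] at hCE

lemma pre_subset_iff (h : IsRestriction t i ρ D) {C E : Finset (Fin m)} (hC : C ∈ t.clades)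
    (hfar : t.Far i C) (hE : E ∈ t.clades) : pre ρ C ⊆ pre ρ E ↔ C ⊆ E :=
  ⟨h.subset_of_pre hC hfar hE,
    fun hCE => h.pre_subset_pre.2 ((Finset.erase_subset _ _).trans hCE)⟩

lemma pre_injOn (h : IsRestriction t i ρ D) {C E : Finset (Fin m)} (hC : C ∈ t.clades)
    (hC' : t.Far i C) (hE : E ∈ t.clades) (hE' : t.Far i E) (hCE : pre ρ C = pre ρ E) : C = E :=
  (h.subset_of_pre hC hC' hE hCE.subset).antisymm (h.subset_of_pre hE hE' hC hCE.superset)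

/-- If a preimage `C` is not far, then `C.erase i` is a clade with the same image and is far. With
`pre_injOn`, the far vertices are thus exactly represented by the vertices of the reduced tree. -/
lemma exists_far (h : IsRestriction t i ρ D) {E : Finset (Fin n)} (hE : E ∈ D.clades) :
    ∃ C ∈ t.clades, t.Far i C ∧ pre ρ C = E := by
  obtain ⟨hne, C, hC, rfl⟩ := (h.mem_clades E).1 hE
  have hi := (h.pre_nonempty hC).1 hne
  by_cases hfar : i ∈ C ∧ C.erase i ∈ t.clades
  · refine ⟨C.erase i, hfar.2, ⟨?_, fun h1 => Finset.notMem_erase i C h1.1⟩, ?_⟩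
    · intro h1
      exact Finset.notMem_erase i C (h1 ▸ Finset.mem_singleton_self i)
    · exact (h.pre_subset_pre.2 ((Finset.erase_subset _ _).trans (Finset.erase_subset _ _))).antisymm
        (h.pre_subset_pre.2 subset_rfl)
  · exact ⟨C, hC, ⟨hi, hfar⟩, rfl⟩

/-- External edges stay external and internal ones internal: the only clades that could shrink to a
single leaf are pairs `{i, k}`, and these are not far because `{k}` is a clade. -/
lemma card_pre_eq_one (h : IsRestriction t i ρ D) {C : Finset (Fin m)} (hC : C ∈ t.clades)
    (hfar : t.Far i C) : (pre ρ C).card = 1 ↔ C.card = 1 := by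
  rw [h.card_pre]
  by_cases hi : i ∈ C
  · constructor
    · intro h1
      obtain ⟨k, hk⟩ := Finset.card_eq_one.1 h1
      exact absurd ⟨hi, hk ▸ t.singleton_mem k⟩ hfar.2
    · intro h1
      obtain ⟨k, rfl⟩ := Finset.card_eq_one.1 h1
      obtain rfl := Finset.mem_singleton.1 hi
      exact absurd rfl hfar.1
  · rw [Finset.erase_eq_of_notMem hi]

lemma pre_mem_branchPoints (h : IsRestriction t i ρ D) {C : Finset (Fin m)}
    (hC : C ∈ t.branchPoints) (hfar : t.Far i C) : pre ρ C ∈ D.branchPoints := by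
  obtain ⟨hC, h2⟩ := Finset.mem_filter.1 hC
  refine Finset.mem_filter.2 ⟨h.pre_mem hC hfar.1, ?_⟩
  have h1 := h.card_pre_eq_one hC hfar
  have h3 := ((h.pre_nonempty hC).2 hfar.1).card_pos
  omega

/-- Deleting leaf `i` maps the insertable parts of `t` that are far from `i` to insertable
parts. -/
def part (h : IsRestriction t i ρ D) :
    (x : t.InsertablePart) → t.Far i (t.vertex x) → D.InsertablePart
  | .inl C, hx => .inl ⟨pre ρ C.1, h.pre_mem C.2 hx.1⟩
  | .inr v, hx => .inr ⟨pre ρ v.1, h.pre_mem_branchPoints v.2 hx⟩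

lemma vertex_part (h : IsRestriction t i ρ D) (x : t.InsertablePart)
    (hx : t.Far i (t.vertex x)) : D.vertex (h.part x hx) = pre ρ (t.vertex x) := by
  rcases x with C | v <;> rfl

lemma isLeft_part (h : IsRestriction t i ρ D) (x : t.InsertablePart)
    (hx : t.Far i (t.vertex x)) : (h.part x hx).isLeft = x.isLeft := by
  rcases x with C | v <;> rfl

end IsRestriction

/-! ### Deletion and insertion commute -/

/-- Extending a relabelling by the new largest label. -/
def extendLast (ρ : Fin n → Fin m) : Fin (n + 1) → Fin (m + 1) :=
  Fin.lastCases (Fin.last m) fun k => (ρ k).castSucc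

@[simp] lemma extendLast_last (ρ : Fin n → Fin m) : extendLast ρ (Fin.last n) = Fin.last m := by
  simp [extendLast]

@[simp] lemma extendLast_castSucc (ρ : Fin n → Fin m) (k : Fin n) :
    extendLast ρ k.castSucc = (ρ k).castSucc := by
  simp [extendLast]

@[simp] lemma mem_lift_castSucc {C : Finset (Fin n)} {k : Fin n} :
    k.castSucc ∈ lift C ↔ k ∈ C := castSucc_mem_lift

@[simp] lemma last_mem_lift {C : Finset (Fin n)} : Fin.last n ∈ lift C ↔ False :=
  iff_false_intro last_notMem_lift

/-- When both leaves are old, swapping and deleting only shifts the new largest label, so the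
relabelling extends the one used before the insertion. -/
lemma swapDelete_castSucc (i j : Fin (n + 1)) :
    swapDelete i.castSucc j.castSucc = extendLast (swapDelete i j) := by
  funext k
  induction k using Fin.lastCases with
  | last =>
    rw [swapDelete, extendLast_last, Fin.succAbove_of_le_castSucc _ _
      (by rw [Fin.castSucc_le_castSucc_iff]; exact Fin.le_last j), Fin.succ_last]
    exact Equiv.swap_apply_of_ne_of_ne (Fin.castSucc_lt_last i).ne' (Fin.castSucc_lt_last j).ne'
  | cast k =>
    rw [extendLast_castSucc, swapDelete, swapDelete, Fin.castSucc_succAbove_castSucc]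
    exact (Fin.castSucc_injective _).swap_apply i j (j.succAbove k)

lemma pre_extendLast_lift (ρ : Fin n → Fin m) (C : Finset (Fin m)) :
    pre (extendLast ρ) (lift C) = lift (pre ρ C) := by
  ext k
  induction k using Fin.lastCases <;> simp

lemma pre_extendLast_insert (ρ : Fin n → Fin m) (C : Finset (Fin m)) :
    pre (extendLast ρ) (insert (Fin.last m) (lift C)) = insert (Fin.last n) (lift (pre ρ C)) := by
  ext k
  induction k using Fin.lastCases <;> simp [(Fin.castSucc_lt_last _).ne]

lemma pre_extendLast_singleton (ρ : Fin n → Fin m) :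
    pre (extendLast ρ) {Fin.last m} = {Fin.last n} := by
  ext k
  induction k using Fin.lastCases <;> simp [(Fin.castSucc_lt_last _).ne]

/-- Deletion commutes with insertion into a part far from `i`: an inserted tree is described by
inclusions of the vertex of `x` in other vertices, and `pre_subset_iff` shows that the deletion
preserves these. -/
lemma IsRestriction.eq_insertLeaf {t : LeafTree m} {i : Fin m} {ρ : Fin n → Fin m}
    {D : LeafTree n} (h : IsRestriction t i ρ D) {x : t.InsertablePart}
    (hx : t.Far i (t.vertex x)) {D' : LeafTree (n + 1)}
    (h' : IsRestriction (t.insertLeaf x) i.castSucc (extendLast ρ) D') :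
    D' = D.insertLeaf (h.part x hx) := by
  have hv := t.vertex_mem x
  ext F
  rw [h'.mem_clades, mem_insertLeaf, h.vertex_part]
  constructor
  · rintro ⟨hne, C, hC, rfl⟩
    rcases (t.mem_insertLeaf x C).1 hC with ⟨E, hE, hxE, rfl⟩ | ⟨E, hE, hxE, rfl⟩ | rfl
    · refine Or.inl ⟨pre ρ E, h.pre_mem hE ?_, (h.pre_subset_iff hv hx hE).2 hxE,
        (pre_extendLast_insert ρ E).symm⟩
      rintro rfl
      rcases Finset.subset_singleton_iff.1 hxE with h1 | h1
      · exact (t.nonempty_of_mem hv).ne_empty h1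
      · exact hx.1 h1
    · rw [pre_extendLast_lift] at hne ⊢
      have hne' : (pre ρ E).Nonempty := Finset.map_nonempty.1 hne
      refine Or.inr (Or.inl ⟨pre ρ E, h.pre_mem hE ((h.pre_nonempty hE).1 hne'), ?_, rfl⟩)
      rw [Stays, h.vertex_part, h.isLeft_part]
      rcases hxE with h1 | ⟨h1, rfl⟩
      · exact Or.inl fun h2 => h1 ((h.pre_subset_iff hv hx hE).1 h2)
      · exact Or.inr ⟨h1, rfl⟩
    · exact Or.inr (Or.inr (pre_extendLast_singleton ρ))
  · rintro (⟨E, hE, hxE, rfl⟩ | ⟨E, hE, hxE, rfl⟩ | rfl)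
    · obtain ⟨C, hC, -, rfl⟩ := h.exists_far hE
      exact ⟨Finset.insert_nonempty _ _, _, (t.mem_insertLeaf x _).2
        (Or.inl ⟨C, hC, (h.pre_subset_iff hv hx hC).1 hxE, rfl⟩), pre_extendLast_insert ρ C⟩
    · refine ⟨Finset.map_nonempty.2 (D.nonempty_of_mem hE), ?_⟩
      rw [Stays, h.vertex_part, h.isLeft_part] at hxE
      rcases hxE with h1 | ⟨h1, rfl⟩
      · obtain ⟨C, hC, -, rfl⟩ := h.exists_far hE
        exact ⟨_, (t.mem_insertLeaf x _).2 (Or.inr (Or.inl ⟨C, hC,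
          Or.inl fun h2 => h1 ((h.pre_subset_iff hv hx hC).2 h2), rfl⟩)), pre_extendLast_lift ρ C⟩
      · exact ⟨_, (t.mem_insertLeaf x _).2 (Or.inr (Or.inl ⟨_, hv, Or.inr ⟨h1, rfl⟩, rfl⟩)),
          pre_extendLast_lift ρ _⟩
    · exact ⟨Finset.singleton_nonempty _, _, (t.mem_insertLeaf x _).2 (Or.inr (Or.inr rfl)),
        pre_extendLast_singleton ρ⟩

/-! ### Deletions that undo an insertion -/

lemma pre_castSucc_lift (C : Finset (Fin n)) : pre Fin.castSucc (lift C) = C := by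
  ext k
  simp

lemma pre_castSucc_insert (C : Finset (Fin n)) :
    pre Fin.castSucc (insert (Fin.last n) (lift C)) = C := by
  ext k
  simp [(Fin.castSucc_lt_last _).ne]

lemma swapDelete_last_last : swapDelete (Fin.last n) (Fin.last n) = Fin.castSucc := by
  funext k
  simp [swapDelete]

/-- Forgetting the new leaf returns each clade to its original; a new branch point on an edge merges
with the upper endpoint of that edge. -/
lemma isRestriction_castSucc_eq {t : LeafTree n} {x : t.InsertablePart} {D : LeafTree n}
    (h : IsRestriction (t.insertLeaf x) (Fin.last n) Fin.castSucc D) : D = t := by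
  ext F
  rw [h.mem_clades]
  constructor
  · rintro ⟨hne, C, hC, rfl⟩
    rcases (t.mem_insertLeaf x C).1 hC with ⟨E, hE, -, rfl⟩ | ⟨E, hE, -, rfl⟩ | rfl
    · rwa [pre_castSucc_insert]
    · rwa [pre_castSucc_lift]
    · obtain ⟨k, hk⟩ := hne
      simp [(Fin.castSucc_lt_last _).ne] at hk
  · intro hF
    refine ⟨t.nonempty_of_mem hF, ?_⟩
    by_cases hx : t.vertex x ⊆ F
    · exact ⟨_, (t.mem_insertLeaf x _).2 (Or.inl ⟨F, hF, hx, rfl⟩), pre_castSucc_insert F⟩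
    · exact ⟨_, (t.mem_insertLeaf x _).2 (Or.inr (Or.inl ⟨F, hF, Or.inl hx, rfl⟩)),
        pre_castSucc_lift F⟩

lemma mem_pre_swapDelete_last_lift {i k : Fin n} {C : Finset (Fin n)} :
    k ∈ pre (swapDelete i.castSucc (Fin.last n)) (lift C) ↔ k ∈ C.erase i := by
  by_cases hk : k = i
  · subst hk
    simp [swapDelete]
  · have : swapDelete i.castSucc (Fin.last n) k = k.castSucc := by
      rw [swapDelete, Fin.succAbove_last]
      exact Equiv.swap_apply_of_ne_of_ne (by simpa using hk) (Fin.castSucc_lt_last _).ne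
    simp [this, hk]

lemma mem_pre_swapDelete_last_insert {i k : Fin n} {C : Finset (Fin n)} :
    k ∈ pre (swapDelete i.castSucc (Fin.last n)) (insert (Fin.last n) (lift C)) ↔
      k ∈ insert i C := by
  by_cases hk : k = i
  · subst hk
    simp [swapDelete]
  · have : swapDelete i.castSucc (Fin.last n) k = k.castSucc := by
      rw [swapDelete, Fin.succAbove_last]
      exact Equiv.swap_apply_of_ne_of_ne (by simpa using hk) (Fin.castSucc_lt_last _).ne
    simp [this, hk, (Fin.castSucc_lt_last _).ne]

lemma pre_swapDelete_last_lift (i : Fin n) (C : Finset (Fin n)) :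
    pre (swapDelete i.castSucc (Fin.last n)) (lift C) = C.erase i :=
  Finset.ext fun _ => mem_pre_swapDelete_last_lift

lemma pre_swapDelete_last_insert (i : Fin n) (C : Finset (Fin n)) :
    pre (swapDelete i.castSucc (Fin.last n)) (insert (Fin.last n) (lift C)) = insert i C :=
  Finset.ext fun _ => mem_pre_swapDelete_last_insert

/-- Swapping leaf `i` with the new leaf and deleting `i` undoes an insertion near leaf `i`. -/
lemma isRestriction_swapDelete_last_eq {t : LeafTree n} {x : t.InsertablePart} {i : Fin n}
    {D : LeafTree n} (h : IsRestriction (t.insertLeaf x) i.castSucc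
      (swapDelete i.castSucc (Fin.last n)) D) (hi : i ∈ t.vertex x)
    (h1 : ∀ C ∈ t.clades, i ∈ C → t.vertex x ⊆ C ∨ C = {i})
    (h2 : x.isLeft = true → t.vertex x = {i} ∨ (t.vertex x).erase i ∈ t.clades) : D = t := by
  -- The new leaf inherits the label `i`: clades with the new leaf gain `i` and all others lose it.
  -- By `h1`, clades containing `i` keep it, except `{i}`, which is supplied by the new leaf; by
  -- `h2`, the upper endpoint of a subdivided edge, deprived of `i`, is empty or was a clade
  -- already.
  have hs : pre (swapDelete i.castSucc (Fin.last n)) {Fin.last n} = {i} := by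
    have := pre_swapDelete_last_insert i ∅
    simpa [lift] using this
  ext F
  rw [h.mem_clades]
  constructor
  · rintro ⟨hne, C, hC, rfl⟩
    rcases (t.mem_insertLeaf x C).1 hC with ⟨E, hE, hxE, rfl⟩ | ⟨E, hE, hxE, rfl⟩ | rfl
    · rwa [pre_swapDelete_last_insert, Finset.insert_eq_of_mem (hxE hi)]
    · rw [pre_swapDelete_last_lift] at hne ⊢
      rcases hxE with h3 | ⟨h3, rfl⟩
      · by_cases hiE : i ∈ E
        · rcases h1 E hE hiE with h4 | rfl
          · exact absurd h4 h3
          · simp at hne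
        · rwa [Finset.erase_eq_of_notMem hiE]
      · rcases h2 h3 with h4 | h4
        · rw [h4] at hne
          simp at hne
        · exact h4
    · rw [hs]
      exact t.singleton_mem i
  · intro hF
    refine ⟨t.nonempty_of_mem hF, ?_⟩
    by_cases hiF : i ∈ F
    · rcases h1 F hF hiF with h3 | rfl
      · exact ⟨_, (t.mem_insertLeaf x _).2 (Or.inl ⟨F, hF, h3, rfl⟩), by
          rw [pre_swapDelete_last_insert, Finset.insert_eq_of_mem hiF]⟩
      · exact ⟨_, (t.mem_insertLeaf x _).2 (Or.inr (Or.inr rfl)), hs⟩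
    · exact ⟨_, (t.mem_insertLeaf x _).2 (Or.inr (Or.inl ⟨F, hF, Or.inl fun h3 => hiF (h3 hi),
        rfl⟩)), by rw [pre_swapDelete_last_lift, Finset.erase_eq_of_notMem hiF]⟩

end LeafTree

namespace LeafTree

variable {n m : ℕ}

/-! ### Children, parents and least labels -/

lemma mem_children {t : LeafTree n} {v C : Finset (Fin n)} :
    C ∈ t.children v ↔ C ∈ t.clades ∧ C ⊂ v ∧ ∀ E ∈ t.clades, C ⊂ E → ¬ E ⊂ v :=
  Finset.mem_filter

lemma exists_child (t : LeafTree n) {v C : Finset (Fin n)} (hC : C ∈ t.clades) (hCv : C ⊂ v) :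
    ∃ E ∈ t.children v, C ⊆ E := by
  obtain ⟨E, hE⟩ := (t.clades.filter fun E => C ⊆ E ∧ E ⊂ v).exists_maximal
    ⟨C, Finset.mem_filter.2 ⟨hC, subset_rfl, hCv⟩⟩
  have hE1 := Finset.mem_filter.1 hE.1
  refine ⟨E, mem_children.2 ⟨hE1.1, hE1.2.2, fun G hG hEG hGv => ?_⟩, hE1.2.1⟩
  exact hEG.2 (hE.2 (Finset.mem_filter.2 ⟨hG, hE1.2.1.trans hEG.1, hGv⟩) hEG.1)

lemma parent_eq {t : LeafTree n} {C v : Finset (Fin n)} (hv : v ∈ t.clades) (hCv : C ⊂ v)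
    (hmin : ∀ D ∈ t.clades, C ⊂ D → v ⊆ D) : t.parent C = v := by
  ext k
  simp only [parent, Finset.mem_filter, Finset.mem_univ, true_and]
  exact ⟨fun hk => hk v hv hCv, fun hk D hD hCD => hmin D hD hCD hk⟩

lemma parent_univ (t : LeafTree n) : t.parent Finset.univ = Finset.univ := by
  ext k
  simp only [parent, Finset.mem_filter, Finset.mem_univ, true_and, iff_true]
  exact fun D _ hD => absurd (Finset.subset_univ D) hD.2

lemma parent_spec (t : LeafTree n) {C : Finset (Fin n)} (hC : C ∈ t.clades)
    (hne : C ≠ Finset.univ) : t.parent C ∈ t.branchPoints ∧ C ∈ t.children (t.parent C) ∧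
      ∀ D ∈ t.clades, C ⊂ D → t.parent C ⊆ D := by
  obtain ⟨v, hv, hCv⟩ := t.exists_parent hC hne
  have hCv' := mem_children.1 hCv
  have hv' := (Finset.mem_filter.1 hv).1
  have hmin : ∀ D ∈ t.clades, C ⊂ D → v ⊆ D := by
    intro D hD hCD
    rcases t.subset_or_subset hC hv' hD hCv'.2.1.1 hCD.1 with h | h
    · exact h
    · by_contra h1
      exact hCv'.2.2 D hD hCD ⟨h, h1⟩
  rw [parent_eq hv' hCv'.2.1 hmin]
  exact ⟨hv, hCv, hmin⟩

lemma singleton_ne_univ (i : Fin (n + 2)) : ({i} : Finset (Fin (n + 2))) ≠ Finset.univ := by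
  intro h
  have := congrArg Finset.card h
  simp at this

lemma mem_parent_singleton (t : LeafTree (n + 2)) (i : Fin (n + 2)) : i ∈ t.parent {i} :=
  (mem_children.1 (t.parent_spec (t.singleton_mem i) (singleton_ne_univ i)).2.1).2.1.1
    (Finset.mem_singleton_self i)

lemma parent_singleton_subset (t : LeafTree (n + 2)) {i : Fin (n + 2)} {C : Finset (Fin (n + 2))}
    (hC : C ∈ t.clades) (hi : i ∈ C) : t.parent {i} ⊆ C ∨ C = {i} := by
  by_cases h : C = {i}
  · exact Or.inr h
  · exact Or.inl ((t.parent_spec (t.singleton_mem i) (singleton_ne_univ i)).2.2 C hC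
      ((Finset.singleton_subset_iff.2 hi).ssubset_of_ne (Ne.symm h)))

/-- The parent of leaf `i` has two children iff it vanishes when leaf `i` is deleted. -/
lemma erase_parent_mem_iff (t : LeafTree (n + 2)) (i : Fin (n + 2)) :
    (t.parent {i}).erase i ∈ t.clades ↔ t.numChildren (t.parent {i}) < 3 := by
  obtain ⟨hv, hiv, hmin⟩ := t.parent_spec (t.singleton_mem i) (singleton_ne_univ i)
  have hi := t.mem_parent_singleton i
  set v := t.parent {i} with hvdef
  constructor
  · intro hA
    -- A further child avoids `i`, so it would lie strictly below the clade `v.erase i`, which is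
    -- itself strictly below `v`.
    have hsub : t.children v ⊆ {{i}, v.erase i} := by
      intro E hE
      rw [Finset.mem_insert, Finset.mem_singleton]
      by_contra! hne
      have hE' := mem_children.1 hE
      have hiE := t.children_disjoint hE hiv hne.1
      rw [Finset.disjoint_singleton_right] at hiE
      exact hE'.2.2 _ hA ((Finset.subset_erase.2 ⟨hE'.2.1.1, hiE⟩).ssubset_of_ne hne.2)
        (Finset.erase_ssubset hi)
    have h1 := (Finset.card_le_card hsub).trans Finset.card_le_two
    exact Nat.lt_succ_of_le h1
  · intro hlt
    have h2 := t.two_le_numChildren hv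
    have h3 : ((t.children v).erase {i}).card = 1 := by
      rw [Finset.card_erase_of_mem hiv]
      simp only [numChildren] at hlt h2
      omega
    obtain ⟨E, hE⟩ := Finset.card_eq_one.1 h3
    have hE' : E ∈ (t.children v).erase {i} := hE ▸ Finset.mem_singleton_self E
    have hEv := Finset.mem_of_mem_erase hE'
    have hEcl := mem_children.1 hEv
    have hiE := t.children_disjoint hEv hiv (Finset.ne_of_mem_erase hE')
    rw [Finset.disjoint_singleton_right] at hiE
    have : v.erase i = E := by
      refine Finset.Subset.antisymm (fun k hk => ?_) (Finset.subset_erase.2 ⟨hEcl.2.1.1, hiE⟩)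
      have hki := Finset.ne_of_mem_erase hk
      have hkv : ({k} : Finset (Fin (n + 2))) ⊂ v :=
        (Finset.singleton_subset_iff.2 (Finset.mem_of_mem_erase hk)).ssubset_of_ne fun h =>
          hki (Finset.mem_singleton.1 (h ▸ hi)).symm
      obtain ⟨G, hG, hkG⟩ := t.exists_child (t.singleton_mem k) hkv
      rw [Finset.singleton_subset_iff] at hkG
      have hGi : G ≠ {i} := by
        rintro rfl
        exact hki (Finset.mem_singleton.1 hkG)
      have hG' : G ∈ (t.children v).erase {i} := Finset.mem_erase.2 ⟨hGi, hG⟩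
      rw [hE, Finset.mem_singleton] at hG'
      exact hG' ▸ hkG
    rw [this]
    exact hEcl.1

/-- Each clade strictly below `v` lies in a child, so minimality may be tested on all of them. This
form avoids tracking children through an insertion. -/
lemma mem_leastLabels (t : LeafTree n) {v : Finset (Fin n)} (hv : v ∈ t.branchPoints)
    {k : Fin n} : k ∈ t.leastLabels v ↔
      k ∈ v ∧ ∀ D ∈ t.clades, D ⊂ v → k ∈ D → ∀ l ∈ D, k ≤ l := by
  obtain ⟨-, hv2⟩ := Finset.mem_filter.1 hv
  simp only [leastLabels, Finset.mem_filter, Finset.mem_univ, true_and]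
  constructor
  · rintro ⟨E, hE, hkE, hle⟩
    refine ⟨(mem_children.1 hE).2.1.1 hkE, fun D hD hDv hkD l hl => hle l ?_⟩
    obtain ⟨G, hG, hDG⟩ := t.exists_child hD hDv
    have : G = E := by
      by_contra hne
      exact Finset.disjoint_left.1 (t.children_disjoint hG hE hne) (hDG hkD) hkE
    exact this ▸ hDG hl
  · rintro ⟨hkv, h⟩
    have hss : ({k} : Finset (Fin n)) ⊂ v := by
      refine (Finset.singleton_subset_iff.2 hkv).ssubset_of_ne ?_
      rintro rfl
      simp at hv2
    obtain ⟨E, hE, hkE⟩ := t.exists_child (t.singleton_mem k) hss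
    have hE' := mem_children.1 hE
    rw [Finset.singleton_subset_iff] at hkE
    exact ⟨E, hE, hkE, h E hE'.1 hE'.2.1 hkE⟩

/-! ### Weights after a deletion -/

/-- The weight of the insertable part of the tree without leaf `i` that corresponds to an
insertable part far from `i`. -/
def restWeight (α γ : ℝ) (t : LeafTree n) (i : Fin n) : t.InsertablePart → ℝ
  | .inl C => if C.1.card = 1 then 1 - α else γ
  | .inr v => ((((t.children v.1).erase {i}).card : ℝ) - 1) * α - γ

namespace IsRestriction

variable {t : LeafTree m} {i : Fin m} {ρ : Fin n → Fin m} {D : LeafTree n}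

/-- A far vertex loses only the child `{i}`. A child that is contracted because it is the binary
parent of `i` is replaced by its other child, which has the same image. -/
lemma children_pre (h : IsRestriction t i ρ D) {u : Finset (Fin m)} (hu : u ∈ t.clades)
    (hfar : t.Far i u) : D.children (pre ρ u) = ((t.children u).erase {i}).image (pre ρ) := by
  ext F
  rw [mem_children, Finset.mem_image]
  constructor
  · rintro ⟨hF, hFu, hmax⟩
    obtain ⟨C, hC, hCfar, rfl⟩ := h.exists_far hF
    have hCu : C ⊂ u := by
      refine ⟨h.subset_of_pre hC hCfar hu hFu.1, fun h1 => hFu.2 ?_⟩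
      exact (h.pre_subset_iff hu hfar hC).2 h1
    obtain ⟨E, hE, hCE⟩ := t.exists_child hC hCu
    have hE' := mem_children.1 hE
    have hEi : E ≠ {i} := by
      rintro rfl
      rcases Finset.subset_singleton_iff.1 hCE with h1 | h1
      · exact (t.nonempty_of_mem hC).ne_empty h1
      · exact hCfar.1 h1
    refine ⟨E, Finset.mem_erase.2 ⟨hEi, hE⟩, ?_⟩
    have h1 : pre ρ C ⊆ pre ρ E := (h.pre_subset_iff hC hCfar hE'.1).2 hCE
    by_contra hne
    refine hmax _ (h.pre_mem hE'.1 hEi) (h1.ssubset_of_ne (Ne.symm hne)) ⟨?_, fun h2 => ?_⟩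
    · exact h.pre_subset_pre.2 ((Finset.erase_subset _ _).trans hE'.2.1.1)
    · exact hE'.2.1.2 (h.subset_of_pre hu hfar hE'.1 h2)
  · rintro ⟨E, hE, rfl⟩
    obtain ⟨hEi, hE⟩ := Finset.mem_erase.1 hE
    obtain ⟨hE, hEu, hmax⟩ := mem_children.1 hE
    refine ⟨h.pre_mem hE hEi, ⟨?_, fun h2 => hEu.2 (h.subset_of_pre hu hfar hE h2)⟩, ?_⟩
    · exact h.pre_subset_pre.2 ((Finset.erase_subset _ _).trans hEu.1)
    · intro G hG hEG hGu
      obtain ⟨C, hC, hCfar, rfl⟩ := h.exists_far hG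
      have hCu : C ⊂ u := by
        refine ⟨h.subset_of_pre hC hCfar hu hGu.1, fun h1 => hGu.2 ?_⟩
        exact (h.pre_subset_iff hu hfar hC).2 h1
      rcases t.nested E hE C hC with h1 | h1 | h1
      · refine hmax C hC (h1.ssubset_of_ne ?_) hCu
        rintro rfl
        exact hEG.2 subset_rfl
      · exact hEG.2 (h.pre_subset_pre.2 ((Finset.erase_subset _ _).trans h1))
      · obtain ⟨l, hl⟩ := (h.pre_nonempty hE).2 hEi
        exact Finset.disjoint_left.1 h1 (mem_pre.1 hl) (mem_pre.1 (hEG.1 hl))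

lemma numChildren_pre (h : IsRestriction t i ρ D) {u : Finset (Fin m)} (hu : u ∈ t.clades)
    (hfar : t.Far i u) : D.numChildren (pre ρ u) = ((t.children u).erase {i}).card := by
  rw [numChildren, h.children_pre hu hfar]
  refine Finset.card_image_of_injOn fun E hE G hG hEG => ?_
  obtain ⟨hEi, hE⟩ := Finset.mem_erase.1 hE
  obtain ⟨-, hG⟩ := Finset.mem_erase.1 hG
  by_contra hne
  obtain ⟨l, hl⟩ := (h.pre_nonempty (mem_children.1 hE).1).2 hEi
  exact Finset.disjoint_left.1 (t.children_disjoint hE hG hne) (mem_pre.1 hl)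
    (mem_pre.1 ((show pre ρ E = pre ρ G from hEG) ▸ hl))

/-- This allows growth of the reduced tree to be summed over parts of the original tree,
independently of the leaf `j` found by the search. -/
lemma weight_part (h : IsRestriction t i ρ D) (α γ : ℝ) (x : t.InsertablePart)
    (hx : t.Far i (t.vertex x)) : D.weight α γ (h.part x hx) = t.restWeight α γ i x := by
  rcases x with C | v
  · have := h.card_pre_eq_one C.2 hx
    simp only [weight, part, restWeight, this]
  · have := h.numChildren_pre (Finset.mem_filter.1 v.2).1 hx
    simp only [weight, part, restWeight, this]

open scoped Classical in
/-- The growth step after deleting leaf `i`, as a sum over the parts far from `i` of the original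
tree. -/
lemma sum_weight_insertLeaf (h : IsRestriction t i ρ D) (α γ : ℝ)
    (D' : t.InsertablePart → LeafTree (n + 1))
    (h' : ∀ x, IsRestriction (t.insertLeaf x) i.castSucc (extendLast ρ) (D' x))
    (f : LeafTree (n + 1) → ℝ≥0∞) :
    ∑ y, ENNReal.ofReal (D.weight α γ y) * f (D.insertLeaf y) =
      ∑ x, if t.Far i (t.vertex x) then ENNReal.ofReal (t.restWeight α γ i x) * f (D' x)
        else 0 := by
  rw [← Finset.sum_filter]
  symm
  refine Finset.sum_bij (fun x hx => h.part x (Finset.mem_filter.1 hx).2)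
    (fun _ _ => Finset.mem_univ _) ?_ ?_ ?_
  · intro x hx y hy hxy
    have hx := (Finset.mem_filter.1 hx).2
    have hy := (Finset.mem_filter.1 hy).2
    have h1 : t.vertex x = t.vertex y := by
      refine h.pre_injOn (t.vertex_mem x) hx (t.vertex_mem y) hy ?_
      rw [← h.vertex_part x hx, ← h.vertex_part y hy, hxy]
    have h2 : x.isLeft = y.isLeft := by
      rw [← h.isLeft_part x hx, ← h.isLeft_part y hy, hxy]
    rcases x with C | v <;> rcases y with E | w
    · exact congrArg Sum.inl (Subtype.ext h1)
    · simp at h2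
    · simp at h2
    · exact congrArg Sum.inr (Subtype.ext h1)
  · rintro (E | w) -
    · obtain ⟨C, hC, hfar, hCE⟩ := h.exists_far E.2
      exact ⟨.inl ⟨C, hC⟩, Finset.mem_filter.2 ⟨Finset.mem_univ _, hfar⟩,
        congrArg Sum.inl (Subtype.ext hCE)⟩
    · obtain ⟨hw, hw2⟩ := Finset.mem_filter.1 w.2
      obtain ⟨C, hC, hfar, hCw⟩ := h.exists_far hw
      have hcard : 2 ≤ C.card := by
        rw [← hCw, h.card_pre] at hw2
        exact hw2.trans (Finset.card_le_card (Finset.erase_subset _ _))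
      exact ⟨.inr ⟨C, Finset.mem_filter.2 ⟨hC, hcard⟩⟩,
        Finset.mem_filter.2 ⟨Finset.mem_univ _, hfar⟩, congrArg Sum.inr (Subtype.ext hCw)⟩
  · intro x hx
    have hx := (Finset.mem_filter.1 hx).2
    rw [h.weight_part, ← h.eq_insertLeaf hx (h' x)]

end IsRestriction

end LeafTree

namespace LeafTree

variable {n : ℕ}

/-! ### The surroundings of a leaf after an insertion -/

open scoped Classical in
/-- The vertex `D` after the insertion of a new leaf into `x`. -/
def up (t : LeafTree n) (x : t.InsertablePart) (D : Finset (Fin n)) : Finset (Fin (n + 1)) :=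
  if t.Stays x D then lift D else insert (Fin.last n) (lift D)

/-- The parent of the new leaf after its insertion into `x`. -/
def newParent (t : LeafTree n) (x : t.InsertablePart) : Finset (Fin (n + 1)) :=
  insert (Fin.last n) (lift (t.vertex x))

variable {t : LeafTree n} {x : t.InsertablePart} {C D v : Finset (Fin n)}

@[simp] lemma castSucc_mem_up {k : Fin n} : k.castSucc ∈ t.up x D ↔ k ∈ D := by
  unfold up
  split_ifs <;> simp [(Fin.castSucc_lt_last _).ne]

@[simp] lemma castSucc_mem_newParent {k : Fin n} : k.castSucc ∈ t.newParent x ↔ k ∈ t.vertex x := by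
  simp [newParent, (Fin.castSucc_lt_last _).ne]

@[simp] lemma last_mem_newParent : Fin.last n ∈ t.newParent x := by
  simp [newParent]

lemma last_mem_up : Fin.last n ∈ t.up x D ↔ ¬ t.Stays x D := by
  unfold up
  split_ifs with h <;> simp [h]

lemma subset_iff_castSucc {F G : Finset (Fin (n + 1))} :
    F ⊆ G ↔ (∀ k : Fin n, k.castSucc ∈ F → k.castSucc ∈ G) ∧ (Fin.last n ∈ F → Fin.last n ∈ G) := by
  constructor
  · exact fun h => ⟨fun k hk => h hk, fun hk => h hk⟩
  · rintro ⟨h1, h2⟩ k hk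
    induction k using Fin.lastCases with
    | last => exact h2 hk
    | cast k => exact h1 k hk

lemma up_subset_up : t.up x C ⊆ t.up x D ↔ C ⊆ D ∧ (t.Stays x D → t.Stays x C) := by
  rw [subset_iff_castSucc, last_mem_up, last_mem_up, not_imp_not]
  simp [Finset.subset_iff]

/-- The vertices with the new leaf above them are closed under passing towards the root. Hence `up`
preserves and reflects inclusion. -/
lemma stays_of_subset (h : C ⊆ D) (hD : t.Stays x D) : t.Stays x C := by
  by_contra hC
  have h1 : t.vertex x ⊆ C := by
    by_contra h1
    exact hC (Or.inl h1)
  rcases hD with h2 | ⟨h2, rfl⟩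
  · exact h2 (h1.trans h)
  · exact hC (Or.inr ⟨h2, h.antisymm h1⟩)

lemma up_mono : t.up x C ⊆ t.up x D ↔ C ⊆ D := by
  rw [up_subset_up]
  exact and_iff_left_of_imp fun h => stays_of_subset h

lemma up_ssubset_up : t.up x C ⊂ t.up x D ↔ C ⊂ D := by
  rw [Finset.ssubset_def, Finset.ssubset_def, up_mono, up_mono]

lemma up_subset_newParent : t.up x C ⊆ t.newParent x ↔ C ⊆ t.vertex x := by
  rw [subset_iff_castSucc]
  simp [Finset.subset_iff]

lemma newParent_subset_up : t.newParent x ⊆ t.up x D ↔ ¬ t.Stays x D := by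
  rw [subset_iff_castSucc, last_mem_up]
  simp only [castSucc_mem_newParent, castSucc_mem_up, last_mem_newParent, true_imp_iff]
  refine and_iff_right_of_imp fun h k hk => ?_
  by_contra hkD
  exact h (Or.inl fun h1 => hkD (h1 hk))

/-- Old vertices persist through `up`; besides the new leaf, only its parent can be new. For an
insertion into a branch point, the parent is already among the values of `up`. -/
lemma mem_insertLeaf_iff_up (F : Finset (Fin (n + 1))) :
    F ∈ (t.insertLeaf x).clades ↔
      (∃ D ∈ t.clades, t.up x D = F) ∨ t.newParent x = F ∨ F = {Fin.last n} := by
  rw [mem_insertLeaf]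
  constructor
  · rintro (⟨D, hD, hxD, rfl⟩ | ⟨D, hD, hxD, rfl⟩ | h)
    · by_cases h : t.Stays x D
      · rcases h with h | ⟨-, rfl⟩
        · exact absurd hxD h
        · exact Or.inr (Or.inl rfl)
      · exact Or.inl ⟨D, hD, if_neg h⟩
    · exact Or.inl ⟨D, hD, if_pos hxD⟩
    · exact Or.inr (Or.inr h)
  · rintro (⟨D, hD, rfl⟩ | rfl | h)
    · by_cases h : t.Stays x D
      · exact Or.inr (Or.inl ⟨D, hD, h, (if_pos h).symm⟩)
      · refine Or.inl ⟨D, hD, ?_, (if_neg h).symm⟩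
        by_contra h1
        exact h (Or.inl h1)
    · exact Or.inl ⟨_, t.vertex_mem x, subset_rfl, rfl⟩
    · exact Or.inr (Or.inr h)

lemma up_mem (hD : D ∈ t.clades) : t.up x D ∈ (t.insertLeaf x).clades :=
  (mem_insertLeaf_iff_up _).2 (Or.inl ⟨D, hD, rfl⟩)

lemma newParent_mem : t.newParent x ∈ (t.insertLeaf x).clades :=
  (mem_insertLeaf_iff_up _).2 (Or.inr (Or.inl rfl))

lemma not_up_subset_last (hC : C.Nonempty) : ¬ t.up x C ⊆ {Fin.last n} := by
  intro h
  obtain ⟨k, hk⟩ := hC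
  have := h (castSucc_mem_up.2 hk)
  simp [(Fin.castSucc_lt_last _).ne] at this

lemma stays_vertex_iff : t.Stays x (t.vertex x) ↔ x.isLeft = true := by
  simp [Stays]

lemma up_mem_branchPoints (hv : v ∈ t.branchPoints) :
    t.up x v ∈ (t.insertLeaf x).branchPoints := by
  obtain ⟨hv, h2⟩ := Finset.mem_filter.1 hv
  refine Finset.mem_filter.2 ⟨up_mem hv, h2.trans ?_⟩
  rw [← Finset.card_map Fin.castSuccEmb]
  refine Finset.card_le_card fun k hk => ?_
  obtain ⟨l, hl, rfl⟩ := Finset.mem_map.1 hk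
  exact castSucc_mem_up.2 hl

lemma up_singleton (i : Fin n) : t.up x {i} = {i.castSucc} := by
  have : t.Stays x {i} := by
    by_cases h : t.vertex x ⊆ {i}
    · have h1 : t.vertex x = {i} := by
        rcases Finset.subset_singleton_iff.1 h with h1 | h1
        · exact absurd h1 (t.nonempty_of_mem (t.vertex_mem x)).ne_empty
        · exact h1
      refine Or.inr ⟨?_, h1.symm⟩
      rcases x with C | v
      · rfl
      · have := (Finset.mem_filter.1 v.2).2
        rw [show v.1 = {i} from h1] at this
        simp at this
    · exact Or.inl h
  rw [up, if_pos this]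
  simp [lift]

/-- The only parent relation that changes is the one across a subdivided edge, which `hx` excludes
and `parent_up_edge` treats. -/
lemma parent_up (hC : C ∈ t.clades) (hne : C ≠ Finset.univ)
    (hx : ¬ (x.isLeft = true ∧ C = t.vertex x)) :
    (t.insertLeaf x).parent (t.up x C) = t.up x (t.parent C) := by
  obtain ⟨hv, hCv, hmin⟩ := t.parent_spec hC hne
  refine parent_eq (up_mem (Finset.mem_filter.1 hv).1) (up_ssubset_up.2 (mem_children.1 hCv).2.1) ?_
  intro F hF hCF
  rcases (mem_insertLeaf_iff_up F).1 hF with ⟨D, hD, rfl⟩ | rfl | rfl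
  · exact up_mono.2 (hmin D hD (up_ssubset_up.1 hCF))
  · refine up_subset_newParent.2 (hmin _ (t.vertex_mem x) ?_)
    refine (up_subset_newParent.1 hCF.1).ssubset_of_ne fun h => hCF.2 ?_
    rw [newParent_subset_up, h, stays_vertex_iff]
    exact fun h1 => hx ⟨h1, h⟩
  · exact absurd hCF.1 (not_up_subset_last (t.nonempty_of_mem hC))

lemma parent_up_edge (hx : x.isLeft = true) :
    (t.insertLeaf x).parent (t.up x (t.vertex x)) = t.newParent x := by
  have hst := stays_vertex_iff.2 hx
  refine parent_eq newParent_mem ⟨up_subset_newParent.2 subset_rfl, ?_⟩ ?_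
  · rw [newParent_subset_up]
    exact fun h => h hst
  intro F hF hCF
  rcases (mem_insertLeaf_iff_up F).1 hF with ⟨D, hD, rfl⟩ | rfl | rfl
  · rw [newParent_subset_up]
    have h1 := up_ssubset_up.1 hCF
    rintro (h2 | ⟨-, rfl⟩)
    · exact h2 h1.1
    · exact h1.2 subset_rfl
  · rfl
  · exact absurd hCF.1 (not_up_subset_last (t.nonempty_of_mem (t.vertex_mem x)))

lemma parent_last : (t.insertLeaf x).parent {Fin.last n} = t.newParent x := by
  obtain ⟨k, hk⟩ := t.nonempty_of_mem (t.vertex_mem x)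
  refine parent_eq newParent_mem ⟨by simp, fun h => ?_⟩ ?_
  · have := h (castSucc_mem_newParent.2 hk)
    simp [(Fin.castSucc_lt_last _).ne] at this
  intro F hF hCF
  rcases (mem_insertLeaf_iff_up F).1 hF with ⟨D, hD, rfl⟩ | rfl | rfl
  · rw [newParent_subset_up, ← last_mem_up]
    exact hCF.1 (Finset.mem_singleton_self _)
  · rfl
  · exact absurd subset_rfl hCF.2

/-- The new label is the largest, so it never displaces the minimum of an existing subtree. -/
lemma castSucc_mem_leastLabels_up (hv : v ∈ t.branchPoints) (k : Fin n) :
    k.castSucc ∈ (t.insertLeaf x).leastLabels (t.up x v) ↔ k ∈ t.leastLabels v := by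
  rw [mem_leastLabels _ (up_mem_branchPoints hv), mem_leastLabels _ hv, castSucc_mem_up]
  refine and_congr_right fun hk => ⟨fun h D hD hDv hkD l hl => ?_, fun h F hF hFv hkF l hl => ?_⟩
  · exact Fin.castSucc_le_castSucc_iff.1
      (h _ (up_mem hD) (up_ssubset_up.2 hDv) (castSucc_mem_up.2 hkD) _ (castSucc_mem_up.2 hl))
  · induction l using Fin.lastCases with
    | last => exact Fin.le_last _
    | cast l =>
      rw [Fin.castSucc_le_castSucc_iff]
      rcases (mem_insertLeaf_iff_up F).1 hF with ⟨D, hD, rfl⟩ | rfl | rfl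
      · exact h D hD (up_ssubset_up.1 hFv) (castSucc_mem_up.1 hkF) l (castSucc_mem_up.1 hl)
      · refine h _ (t.vertex_mem x) ⟨?_, fun h1 => hFv.2 (up_subset_newParent.2 h1)⟩
          (castSucc_mem_newParent.1 hkF) l (castSucc_mem_newParent.1 hl)
        exact fun l hl => castSucc_mem_up.1 (hFv.1 (castSucc_mem_newParent.2 hl))
      · simp [(Fin.castSucc_lt_last _).ne] at hkF

/-- The largest label is least in a subtree only if it is alone there, that is, if the new leaf is
itself a child of `v`. -/
lemma last_mem_leastLabels_up (hv : v ∈ t.branchPoints) :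
    Fin.last n ∈ (t.insertLeaf x).leastLabels (t.up x v) ↔ x = .inr ⟨v, hv⟩ := by
  rw [mem_leastLabels _ (up_mem_branchPoints hv), last_mem_up]
  constructor
  · rintro ⟨h1, h2⟩
    have h3 : t.newParent x = t.up x v := by
      by_contra hne
      obtain ⟨k, hk⟩ := t.nonempty_of_mem (t.vertex_mem x)
      have := h2 _ newParent_mem ((newParent_subset_up.2 h1).ssubset_of_ne hne)
        last_mem_newParent _ (castSucc_mem_newParent.2 hk)
      exact absurd this (not_le.2 (Fin.castSucc_lt_last k))
    have h4 : t.vertex x = v := by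
      ext k
      rw [← castSucc_mem_newParent, h3, castSucc_mem_up]
    rcases x with C | w
    · exact absurd (Or.inr ⟨rfl, h4.symm⟩) h1
    · exact congrArg Sum.inr (Subtype.ext h4)
  · rintro rfl
    refine ⟨fun h => by simpa using stays_vertex_iff.1 h, fun F hF hFv hlF l hl => ?_⟩
    rcases (mem_insertLeaf_iff_up F).1 hF with ⟨D, hD, rfl⟩ | rfl | rfl
    · refine absurd (stays_of_subset (up_ssubset_up.1 hFv).1 (Or.inl ?_)) (last_mem_up.1 hlF)
      exact fun h => last_mem_up.1 hlF (Or.inl fun h1 => (up_ssubset_up.1 hFv).2 h1)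
    · exact absurd (up_subset_newParent.2 subset_rfl) hFv.2
    · exact (Finset.mem_singleton.1 hl).ge

lemma leastLabels_up (hv : v ∈ t.branchPoints) (hx : x ≠ .inr ⟨v, hv⟩) :
    (t.insertLeaf x).leastLabels (t.up x v) = (t.leastLabels v).map Fin.castSuccEmb := by
  ext k
  induction k using Fin.lastCases with
  | last => simp [last_mem_leastLabels_up hv, hx, (Fin.castSucc_lt_last _).ne]
  | cast k => simp [castSucc_mem_leastLabels_up hv]

lemma leastLabels_up_branchPoint (hv : v ∈ t.branchPoints) :
    (t.insertLeaf (.inr ⟨v, hv⟩)).leastLabels (t.up (.inr ⟨v, hv⟩) v) =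
      insert (Fin.last n) ((t.leastLabels v).map Fin.castSuccEmb) := by
  ext k
  induction k using Fin.lastCases with
  | last => simp [last_mem_leastLabels_up hv]
  | cast k => simp [castSucc_mem_leastLabels_up hv, (Fin.castSucc_lt_last _).ne]

lemma numChildren_up (hv : v ∈ t.branchPoints) (hx : x ≠ .inr ⟨v, hv⟩) :
    (t.insertLeaf x).numChildren (t.up x v) = t.numChildren v := by
  rw [← card_leastLabels, ← card_leastLabels, leastLabels_up hv hx, Finset.card_map]

lemma numChildren_up_branchPoint (hv : v ∈ t.branchPoints) :
    (t.insertLeaf (.inr ⟨v, hv⟩)).numChildren (t.up (.inr ⟨v, hv⟩) v) = t.numChildren v + 1 := by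
  rw [← card_leastLabels, ← card_leastLabels, leastLabels_up_branchPoint hv,
    Finset.card_insert_of_notMem, Finset.card_map]
  simp [(Fin.castSucc_lt_last _).ne]

end LeafTree

open LeafTree

variable {n : ℕ}

/-- Adding the largest label does not change a minimum. Nonemptiness matters: for `S = ∅` the set
`S'` might consist of the new label alone. -/
lemma leastLabel_eq_castSucc {S : Finset (Fin (n + 1))} {S' : Finset (Fin (n + 2))}
    (h : ∀ k : Fin (n + 1), k.castSucc ∈ S' ↔ k ∈ S) (hS : S.Nonempty) :
    leastLabel S' = (leastLabel S).castSucc := by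
  obtain ⟨k, hk⟩ := hS
  have hS : S.Nonempty := ⟨k, hk⟩
  have hS' : S'.Nonempty := ⟨_, (h k).2 hk⟩
  rw [leastLabel, leastLabel, dif_pos hS, dif_pos hS']
  refine le_antisymm (Finset.min'_le _ _ ((h _).2 (Finset.min'_mem _ _))) ?_
  refine Finset.le_min' _ _ _ fun l hl => ?_
  induction l using Fin.lastCases with
  | last => exact Fin.le_last _
  | cast l => exact Fin.castSucc_le_castSucc_iff.2 (Finset.min'_le _ _ ((h l).1 hl))

lemma leastLabel_empty : leastLabel (∅ : Finset (Fin (n + 1))) = 0 := by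
  simp [leastLabel]

lemma leastLabel_singleton (k : Fin (n + 1)) : leastLabel {k} = k := by
  simp [leastLabel]

/-! ### The local search after an insertion -/

variable {α γ : ℝ}

lemma searchLaw_of_lt (h : Admissible α γ) (t : LeafTree (n + 2)) (i : Fin (n + 2))
    (hc : t.numChildren (t.parent {i}) < 3) :
    searchLaw h t i = PMF.pure (max i (max (leastLabel (t.parent {i} \ {i}))
      (leastLabel (t.parent (t.parent {i}) \ t.parent {i})))) := by
  rw [searchLaw, dif_neg (by omega)]

/-! ### Ranks of least labels and identities for the search probabilities -/

/-- The position of a label in a set of labels, counted from one. -/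
def rank (L : Finset (Fin n)) (k : Fin n) : ℕ := (L.filter fun l => l ≤ k).card

lemma rank_le_card (L : Finset (Fin n)) (k : Fin n) : rank L k ≤ L.card :=
  Finset.card_filter_le _ _

lemma rank_orderEmbOfFin {c : ℕ} (L : Finset (Fin n)) (hL : L.card = c) (k : Fin c) :
    rank L (L.orderEmbOfFin hL k) = k + 1 := by
  have : (L.filter fun l => l ≤ L.orderEmbOfFin hL k) =
      (Finset.Iic k).map (L.orderEmbOfFin hL).toEmbedding := by
    ext l
    simp only [Finset.mem_filter, Finset.mem_map, Finset.mem_Iic, RelEmbedding.coe_toEmbedding]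
    constructor
    · rintro ⟨hl, hle⟩
      have : l ∈ Set.range (L.orderEmbOfFin hL) := by
        rw [Finset.range_orderEmbOfFin]
        exact hl
      obtain ⟨a, rfl⟩ := this
      exact ⟨a, (L.orderEmbOfFin hL).le_iff_le.1 hle, rfl⟩
    · rintro ⟨a, ha, rfl⟩
      exact ⟨L.orderEmbOfFin_mem hL a, (L.orderEmbOfFin hL).le_iff_le.2 ha⟩
  rw [rank, this, Finset.card_map, Fin.card_Iic]

lemma rank_map_castSucc (L : Finset (Fin n)) (k : Fin n) :
    rank (L.map Fin.castSuccEmb) k.castSucc = rank L k := by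
  rw [rank, rank, Finset.filter_map, Finset.card_map]
  congr 1

lemma rank_insert_last_castSucc (L : Finset (Fin n)) (k : Fin n) :
    rank (insert (Fin.last n) (L.map Fin.castSuccEmb)) k.castSucc = rank L k := by
  rw [rank, Finset.filter_insert, if_neg (not_le.2 (Fin.castSucc_lt_last k))]
  exact rank_map_castSucc L k

lemma rank_insert_last_last (L : Finset (Fin n)) :
    rank (insert (Fin.last n) (L.map Fin.castSuccEmb)) (Fin.last n) = L.card + 1 := by
  rw [rank, Finset.filter_true_of_mem fun l _ => Fin.le_last l, Finset.card_insert_of_notMem,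
    Finset.card_map]
  simp [(Fin.castSucc_lt_last _).ne]

lemma expect_searchLaw (h : Admissible α γ) (t : LeafTree (n + 2)) (i : Fin (n + 2))
    (hc : 3 ≤ t.numChildren (t.parent {i})) (f : Fin (n + 2) → ℝ≥0∞) :
    expect (searchLaw h t i) f = ∑ k ∈ t.leastLabels (t.parent {i}),
      ENNReal.ofReal (searchProb α γ (t.numChildren (t.parent {i}))
        (rank (t.leastLabels (t.parent {i})) i) (rank (t.leastLabels (t.parent {i})) k)) * f k := by
  rw [searchLaw, dif_pos hc, expect_map, expect_ofFintype]
  refine Finset.sum_bij (fun k _ => (t.leastLabels (t.parent {i})).orderEmbOfFin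
    (t.card_leastLabels (t.parent {i})) k) ?_ ?_ ?_ ?_
  · exact fun k _ => Finset.orderEmbOfFin_mem _ _ k
  · exact fun k _ l _ hkl => RelEmbedding.injective _ hkl
  · intro l hl
    have : l ∈ Set.range ((t.leastLabels (t.parent {i})).orderEmbOfFin
        (t.card_leastLabels (t.parent {i}))) := by
      rw [Finset.range_orderEmbOfFin]
      exact hl
    obtain ⟨a, rfl⟩ := this
    exact ⟨a, Finset.mem_univ _, rfl⟩
  · intro k _
    rw [rank_orderEmbOfFin]
    rfl

lemma searchProb_self {c : ℕ} (hc : 3 ≤ c) : searchProb α γ c c c = 1 := by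
  unfold searchProb
  by_cases h : ((c : ℝ) - 2) * α - γ = 0
  · rw [if_pos h, if_pos (by omega)]
  · rw [if_neg h, if_neg (by omega), if_pos rfl, div_self h]

/-- With three children, `c - 2 = 1`, so the numerator `α - γ` equals the denominator; the
convention for a vanishing denominator agrees. -/
lemma searchProb_three {j : ℕ} (hj : j ≤ 2) : searchProb α γ 3 j 3 = 1 := by
  unfold searchProb
  by_cases h : (((3 : ℕ) : ℝ) - 2) * α - γ = 0
  · rw [if_pos h, if_pos (by omega)]
  · rw [if_neg h, if_pos hj, if_pos rfl, div_eq_one_iff_eq h]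
    push_cast
    ring

lemma searchProb_eq_zero_of_lt {c j j' : ℕ} (hj : j' < max j 3) : searchProb α γ c j j' = 0 := by
  unfold searchProb
  split_ifs <;> first | rfl | omega

/-- The factor is both the insertion weight of a branch point with `c` children and the search
denominator once it has `c + 1`. It cancels, leaving the numerator `α` of a later child. -/
lemma mul_searchProb_last (h : Admissible α γ) {c j : ℕ} (hc : 3 ≤ c) (hj : j ≤ c) :
    (((c : ℝ) - 1) * α - γ) * searchProb α γ (c + 1) j (c + 1) = α := by
  obtain ⟨h0, h1, -⟩ := h
  have hc' : (3 : ℝ) ≤ c := by exact_mod_cast hc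
  have hden : ((c + 1 : ℕ) : ℝ) - 2 = c - 1 := by
    push_cast
    ring
  unfold searchProb
  rw [hden]
  by_cases hD : ((c : ℝ) - 1) * α - γ = 0
  -- Here `(c - 1) α = γ ≤ α` with `c ≥ 3` forces `α = 0`.
  · rw [hD]
    nlinarith
  · rw [if_neg hD]
    by_cases hj2 : j ≤ 2
    · rw [if_pos hj2, if_neg (by omega), if_pos (by omega), mul_div_cancel₀ _ hD]
    · rw [if_neg hj2, if_neg (by omega), if_pos (by omega), mul_div_cancel₀ _ hD]

/-- The search numerators depend on `j` and `j'` but not on the number of children. The work is in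
checking that the conventions for vanishing denominators respect this. -/
lemma mul_searchProb_succ (h : Admissible α γ) {c j j' : ℕ} (hc : 3 ≤ c) (hj : j ≤ c)
    (hj' : j' ≤ c) : (((c : ℝ) - 1) * α - γ) * searchProb α γ (c + 1) j j' =
      (((c : ℝ) - 2) * α - γ) * searchProb α γ c j j' := by
  obtain ⟨h0, h1, -⟩ := h
  have hc' : (3 : ℝ) ≤ c := by exact_mod_cast hc
  have hden : ((c + 1 : ℕ) : ℝ) - 2 = c - 1 := by
    push_cast
    ring
  by_cases hD : ((c : ℝ) - 1) * α - γ = 0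
  · have hα : α = 0 := by nlinarith
    have hγ : γ = 0 := by linarith
    simp [hα, hγ]
  by_cases hD' : ((c : ℝ) - 2) * α - γ = 0
  -- Only the denominator for `c` vanishes, so `c = 3` and `α = γ ≠ 0`. The right side is zero, and
  -- on the left the one possible target is `j' = 3`, whose numerator is `α - γ = 0`, both for `j ≤
  -- 2` and for `j = 3`.
  · have hαγ : α = γ := by nlinarith
    have hα : α ≠ 0 := by
      rintro rfl
      exact hD (by linarith)
    have hc3 : c = 3 := by
      have : ((c : ℝ) - 3) * α = 0 := by linarith
      rcases mul_eq_zero.1 this with h2 | h2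
      · exact_mod_cast sub_eq_zero.1 h2
      · exact absurd h2 hα
    subst hc3
    rw [hD', zero_mul]
    by_cases hlt : j' < max j 3
    · rw [searchProb_eq_zero_of_lt hlt, mul_zero]
    · obtain rfl : j' = 3 := by omega
      unfold searchProb
      rw [hden, if_neg hD]
      by_cases hj2 : j ≤ 2
      · simp [hj2, hαγ]
      · obtain rfl : j = 3 := by omega
        rw [if_neg hj2, if_pos rfl, mul_div_cancel₀ _ hD]
        exact hD'
  · unfold searchProb
    rw [hden, if_neg hD, if_neg hD']
    split_ifs <;> simp only [mul_div_cancel₀ _ hD, mul_div_cancel₀ _ hD', mul_zero]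

lemma searchLaw_eq_pure_last {h : Admissible α γ} {t : LeafTree (n + 2)} {i : Fin (n + 2)}
    (hc : t.numChildren (t.parent {i}) < 3)
    (hmax : i = Fin.last _ ∨ leastLabel (t.parent {i} \ {i}) = Fin.last _ ∨
      leastLabel (t.parent (t.parent {i}) \ t.parent {i}) = Fin.last _) :
    searchLaw h t i = PMF.pure (Fin.last _) := by
  rw [searchLaw_of_lt h t i hc]
  congr 1
  refine le_antisymm (Fin.le_last _) ?_
  rcases hmax with h1 | h1 | h1 <;> rw [← h1] <;> simp

/-- If the parent of `i` has the leaves of `L` and the new leaf as its least labels, and only the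
last one can be found, then it is found. -/
lemma searchLaw_eq_pure_last_of_leastLabels {h : Admissible α γ} {t : LeafTree (n + 2)}
    {i : Fin (n + 2)} {L : Finset (Fin (n + 1))} (hc : 3 ≤ t.numChildren (t.parent {i}))
    (hL : t.leastLabels (t.parent {i}) = insert (Fin.last _) (L.map Fin.castSuccEmb))
    (h1 : searchProb α γ (t.numChildren (t.parent {i}))
      (rank (t.leastLabels (t.parent {i})) i) (L.card + 1) = 1)
    (h2 : ∀ j ≤ L.card, searchProb α γ (t.numChildren (t.parent {i}))
      (rank (t.leastLabels (t.parent {i})) i) j = 0) :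
    searchLaw h t i = PMF.pure (Fin.last _) := by
  refine pmf_ext_of_expect fun f => ?_
  rw [expect_searchLaw h t i hc, expect_pure]
  generalize t.numChildren (t.parent {i}) = c at h1 h2
  generalize rank (t.leastLabels (t.parent {i})) i = j at h1 h2
  rw [hL, Finset.sum_insert (by simp [(Fin.castSucc_lt_last _).ne]), Finset.sum_map,
    rank_insert_last_last, h1, Finset.sum_eq_zero]
  · simp
  · intro k _
    rw [Fin.castSuccEmb_apply, rank_insert_last_castSucc, h2 _ (rank_le_card _ _)]
    simp

/-! ### The local search according to the place of the insertion -/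

section Insert

variable {t : LeafTree (n + 2)} {x : t.InsertablePart} {i : Fin (n + 2)}

lemma newParent_eq_up {v : Finset (Fin (n + 2))} (hv : v ∈ t.branchPoints) :
    t.newParent (.inr ⟨v, hv⟩) = t.up (.inr ⟨v, hv⟩) v := by
  rw [up, if_neg]
  · rfl
  · exact fun h => by simpa using stays_vertex_iff.1 h

/-- The local search from the new leaf finds the new leaf. -/
lemma searchLaw_insertLeaf_last (h : Admissible α γ) (t : LeafTree (n + 2))
    (x : t.InsertablePart) :
    searchLaw h (t.insertLeaf x) (Fin.last _) = PMF.pure (Fin.last _) := by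
  rcases x with C | ⟨v, hv⟩
  · refine searchLaw_eq_pure_last ?_ (Or.inl rfl)
    rw [← erase_parent_mem_iff, parent_last]
    have hst : t.Stays (.inl C) C.1 := Or.inr ⟨rfl, rfl⟩
    -- Without the new leaf, its parent becomes the old upper endpoint of the edge, still a clade,
    -- so that parent is binary.
    have : (t.newParent (.inl C)).erase (Fin.last _) = t.up (.inl C) C.1 := by
      rw [up, if_pos hst, newParent, Finset.erase_insert last_notMem_lift]
      rfl
    rw [this]
    exact up_mem C.2
  · have hnum := numChildren_up_branchPoint hv
    have hL := leastLabels_up_branchPoint hv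
    have h2 := t.two_le_numChildren hv
    rw [← newParent_eq_up, ← parent_last] at hnum hL
    refine searchLaw_eq_pure_last_of_leastLabels (by omega) hL ?_ fun j hj => ?_
    · rw [hL, rank_insert_last_last, card_leastLabels, hnum]
      exact searchProb_self (by omega)
    · rw [hL, rank_insert_last_last]
      exact searchProb_eq_zero_of_lt (by omega)

/-- The new leaf becomes the only sibling of `i`, so the first spinal bush consists of it alone and
the label `a` is maximal. -/
lemma searchLaw_insertLeaf_edge (h : Admissible α γ) (t : LeafTree (n + 2)) (i : Fin (n + 2)) :
    searchLaw h (t.insertLeaf (.inl ⟨{i}, t.singleton_mem i⟩)) i.castSucc =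
      PMF.pure (Fin.last _) := by
  set x : t.InsertablePart := .inl ⟨{i}, t.singleton_mem i⟩ with hx
  have hpar : (t.insertLeaf x).parent {i.castSucc} = t.newParent x := by
    rw [← up_singleton]
    exact parent_up_edge (x := x) rfl
  have herase : (t.newParent x).erase i.castSucc = {Fin.last _} := by
    ext k
    induction k using Fin.lastCases with
    | last => simp [(Fin.castSucc_lt_last _).ne']
    | cast k => simp [hx, vertex, (Fin.castSucc_lt_last _).ne]
  refine searchLaw_eq_pure_last ?_ (Or.inr (Or.inl ?_))
  · rw [← erase_parent_mem_iff, hpar, herase]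
    exact LeafTree.singleton_mem _ _
  · rw [hpar, Finset.sdiff_singleton_eq_erase, herase]
    exact leastLabel_singleton _

lemma parent_castSucc (hx : ¬ (x.isLeft = true ∧ {i} = t.vertex x)) :
    (t.insertLeaf x).parent {i.castSucc} = t.up x (t.parent {i}) := by
  rw [← up_singleton]
  exact parent_up (t.singleton_mem i) (singleton_ne_univ i) hx

lemma parent_mem_branchPoints (t : LeafTree (n + 2)) (i : Fin (n + 2)) :
    t.parent {i} ∈ t.branchPoints :=
  (t.parent_spec (t.singleton_mem i) (singleton_ne_univ i)).1

lemma singleton_ne_parent (t : LeafTree (n + 2)) (i : Fin (n + 2)) : {i} ≠ t.parent {i} := by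
  intro h
  have := (Finset.mem_filter.1 (parent_mem_branchPoints t i)).2
  rw [← h] at this
  simp at this

/-- The new leaf alone forms the second spinal bush, so the label `b` is maximal. -/
lemma searchLaw_insertLeaf_parentEdge (h : Admissible α γ) (t : LeafTree (n + 2))
    (i : Fin (n + 2)) (hc : t.numChildren (t.parent {i}) < 3) :
    searchLaw h (t.insertLeaf (.inl ⟨t.parent {i},
      (Finset.mem_filter.1 (parent_mem_branchPoints t i)).1⟩)) i.castSucc =
      PMF.pure (Fin.last _) := by
  have hv := parent_mem_branchPoints t i
  set x : t.InsertablePart := .inl ⟨t.parent {i}, (Finset.mem_filter.1 hv).1⟩ with hx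
  have hpar : (t.insertLeaf x).parent {i.castSucc} = t.up x (t.parent {i}) :=
    parent_castSucc fun h1 => singleton_ne_parent t i h1.2
  have hpar2 : (t.insertLeaf x).parent (t.up x (t.parent {i})) = t.newParent x :=
    parent_up_edge (x := x) rfl
  have hst : t.Stays x (t.parent {i}) := Or.inr ⟨rfl, rfl⟩
  refine searchLaw_eq_pure_last ?_ (Or.inr (Or.inr ?_))
  · rw [hpar, numChildren_up hv Sum.inl_ne_inr]
    exact hc
  · have : t.newParent x \ t.up x (t.parent {i}) = {Fin.last _} := by
      ext k
      induction k using Fin.lastCases with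
      | last => simp [last_mem_up, hst]
      | cast k => simp [hx, vertex, (Fin.castSucc_lt_last _).ne]
    rw [hpar, hpar2, this]
    exact leastLabel_singleton _

/-- A binary parent becomes ternary with the new leaf as `i_3`, and a search starting from one of
the first two children can only end at `i_3`. -/
lemma searchLaw_insertLeaf_parent (h : Admissible α γ) (t : LeafTree (n + 2))
    (i : Fin (n + 2)) (hc : t.numChildren (t.parent {i}) < 3) :
    searchLaw h (t.insertLeaf (.inr ⟨t.parent {i}, parent_mem_branchPoints t i⟩)) i.castSucc =
      PMF.pure (Fin.last _) := by
  have hv := parent_mem_branchPoints t i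
  have hpar := parent_castSucc (x := .inr ⟨t.parent {i}, hv⟩) (i := i) (by simp)
  have hnum := numChildren_up_branchPoint hv
  have hL := leastLabels_up_branchPoint hv
  have h2 := t.two_le_numChildren hv
  have h3 := rank_le_card (t.leastLabels (t.parent {i})) i
  rw [card_leastLabels] at h3
  rw [← hpar] at hnum hL
  refine searchLaw_eq_pure_last_of_leastLabels (by omega) hL ?_ fun j hj => ?_
  · rw [hL, rank_insert_last_castSucc, card_leastLabels, hnum,
      show t.numChildren (t.parent {i}) = 2 by omega]
    exact searchProb_three (by omega)
  · rw [card_leastLabels] at hj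
    rw [hL, rank_insert_last_castSucc]
    exact searchProb_eq_zero_of_lt (by omega)

lemma up_univ (hx : ¬ (x.isLeft = true ∧ t.vertex x = Finset.univ)) :
    t.up x Finset.univ = Finset.univ := by
  have : ¬ t.Stays x Finset.univ := by
    rintro (h | h)
    · exact h (Finset.subset_univ _)
    · exact hx ⟨h.1, h.2.symm⟩
  ext k
  induction k using Fin.lastCases with
  | last => simp [last_mem_up, this]
  | cast k => simp

/-- An insertion far from leaf `i` and not into its parent does not affect the local search. -/
lemma searchLaw_insertLeaf_far (h : Admissible α γ) (hfar : t.Far i (t.vertex x))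
    (hx : x ≠ .inr ⟨t.parent {i}, parent_mem_branchPoints t i⟩) :
    searchLaw h (t.insertLeaf x) i.castSucc = (searchLaw h t i).map Fin.castSucc := by
  have hv := parent_mem_branchPoints t i
  have hpar : (t.insertLeaf x).parent {i.castSucc} = t.up x (t.parent {i}) :=
    parent_castSucc fun h1 => hfar.1 h1.2.symm
  have hnum := numChildren_up hv hx
  by_cases hc : t.numChildren (t.parent {i}) < 3
  · have hne : t.vertex x ≠ t.parent {i} := by
      intro h1
      refine hfar.2 ?_
      rw [h1]
      exact ⟨t.mem_parent_singleton i, (t.erase_parent_mem_iff i).2 hc⟩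
    rw [searchLaw_of_lt h t i hc, searchLaw_of_lt h _ _ (by rw [hpar, hnum]; exact hc), hpar,
      PMF.pure_map]
    have ha : leastLabel (t.up x (t.parent {i}) \ {i.castSucc}) =
        (leastLabel (t.parent {i} \ {i})).castSucc := by
      refine leastLabel_eq_castSucc (fun k => by simp) ?_
      rw [Finset.sdiff_nonempty, Finset.subset_singleton_iff, not_or]
      exact ⟨(t.nonempty_of_mem (Finset.mem_filter.1 hv).1).ne_empty,
        (singleton_ne_parent t i).symm⟩
    have hb : leastLabel ((t.insertLeaf x).parent (t.up x (t.parent {i})) \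
        t.up x (t.parent {i})) =
        (leastLabel (t.parent (t.parent {i}) \ t.parent {i})).castSucc := by
      by_cases hu : t.parent {i} = Finset.univ
      · rw [hu, up_univ (fun h1 => hne (h1.2.trans hu.symm)), parent_univ, parent_univ,
          Finset.sdiff_self, Finset.sdiff_self, leastLabel_empty, leastLabel_empty]
        rfl
      · have hvc := (Finset.mem_filter.1 hv).1
        rw [parent_up hvc hu fun h1 => hne h1.2.symm]
        refine leastLabel_eq_castSucc (fun k => by simp) ?_
        rw [Finset.sdiff_nonempty]
        exact (mem_children.1 (t.parent_spec hvc hu).2.1).2.1.2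
    rw [ha, hb, Fin.strictMono_castSucc.monotone.map_max, Fin.strictMono_castSucc.monotone.map_max]
  · refine pmf_ext_of_expect fun f => ?_
    rw [expect_map, expect_searchLaw h t i (by omega),
      expect_searchLaw h _ _ (by rw [hpar, hnum]; omega), hpar, hnum, leastLabels_up hv hx,
      Finset.sum_map, rank_map_castSucc]
    simp only [Fin.castSuccEmb_apply, rank_map_castSucc]

/-- An insertion into the parent `v` of leaf `i`, if `v` has at least three children. -/
lemma expect_searchLaw_insertLeaf_parent (h : Admissible α γ) (t : LeafTree (n + 2))
    (i : Fin (n + 2)) (hc : 3 ≤ t.numChildren (t.parent {i})) (f : Fin (n + 3) → ℝ≥0∞) :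
    ENNReal.ofReal (((t.numChildren (t.parent {i}) : ℝ) - 1) * α - γ) *
        expect (searchLaw h (t.insertLeaf (.inr ⟨t.parent {i}, parent_mem_branchPoints t i⟩))
          i.castSucc) f =
      ENNReal.ofReal α * f (Fin.last _) +
        ENNReal.ofReal (((t.numChildren (t.parent {i}) : ℝ) - 2) * α - γ) *
          expect (searchLaw h t i) fun j => f j.castSucc := by
  have hv := parent_mem_branchPoints t i
  have hpar := parent_castSucc (x := .inr ⟨t.parent {i}, hv⟩) (i := i) (by simp)
  have hnum := numChildren_up_branchPoint hv
  have hL := leastLabels_up_branchPoint hv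
  have hr := rank_le_card (t.leastLabels (t.parent {i})) i
  rw [card_leastLabels] at hr
  have hc' : (3 : ℝ) ≤ t.numChildren (t.parent {i}) := by exact_mod_cast hc
  obtain ⟨h0, h1, -⟩ := id h
  rw [expect_searchLaw h t i hc, expect_searchLaw h _ _ (by rw [hpar, hnum]; omega), hpar, hnum,
    hL, Finset.sum_insert (by simp [(Fin.castSucc_lt_last _).ne]), Finset.sum_map,
    rank_insert_last_last, rank_insert_last_castSucc, card_leastLabels, mul_add, Finset.mul_sum,
    Finset.mul_sum, ← mul_assoc, ← ENNReal.ofReal_mul (by nlinarith),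
    mul_searchProb_last h hc hr]
  congr 1
  refine Finset.sum_congr rfl fun k _ => ?_
  have hk := rank_le_card (t.leastLabels (t.parent {i})) k
  rw [card_leastLabels] at hk
  rw [Fin.castSuccEmb_apply, rank_insert_last_castSucc, ← mul_assoc,
    ← ENNReal.ofReal_mul (by nlinarith), mul_searchProb_succ h hc hr hk,
    ENNReal.ofReal_mul (by nlinarith), mul_assoc]

end Insert

open LeafTree

variable {n : ℕ} {α γ : ℝ}

/-! ### Commutation of the growth step and the down-step from a fixed leaf -/

/-- If removing `i` from a larger clade leaves a clade, that clade must be the parent of `i` and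
must be binary, since nothing else fits between. -/
lemma far_iff {t : LeafTree (n + 2)} {i : Fin (n + 2)} {C : Finset (Fin (n + 2))}
    (hC : C ∈ t.clades) : t.Far i C ↔
      C ≠ {i} ∧ ¬ (C = t.parent {i} ∧ t.numChildren (t.parent {i}) < 3) := by
  refine and_congr_right fun hne => not_congr ⟨fun ⟨hi, he⟩ => ?_, ?_⟩
  · have hv := parent_mem_branchPoints t i
    have hCv : C = t.parent {i} := by
      rcases t.parent_singleton_subset hC hi with h1 | h1
      · refine Finset.Subset.antisymm ?_ h1
        have hiv := t.mem_parent_singleton i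
        rcases t.nested _ (Finset.mem_filter.1 hv).1 _ he with h2 | h2 | h2
        · exact absurd (h2 hiv) (Finset.notMem_erase i C)
        · rw [← Finset.insert_erase hi]
          exact Finset.insert_subset hiv h2
        · obtain ⟨k, hk, hki⟩ := Finset.exists_mem_ne (Finset.mem_filter.1 hv).2 i
          exact absurd (Finset.mem_erase.2 ⟨hki, h1 hk⟩) (Finset.disjoint_left.1 h2 hk)
      · exact absurd h1 hne
    exact ⟨hCv, (t.erase_parent_mem_iff i).1 (hCv ▸ he)⟩
  · rintro ⟨rfl, hc⟩
    exact ⟨t.mem_parent_singleton i, (t.erase_parent_mem_iff i).2 hc⟩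

/-- The part of the weight of `x` for which the local search from leaf `i` finds a new leaf
inserted into `x`. -/
def nearWeight (α γ : ℝ) (t : LeafTree (n + 2)) (i : Fin (n + 2)) : t.InsertablePart → ℝ
  | .inl C => if C.1 = {i} then 1 - α
      else if C.1 = t.parent {i} ∧ t.numChildren (t.parent {i}) < 3 then γ else 0
  | .inr u => if u.1 = t.parent {i} then
      (if t.numChildren (t.parent {i}) < 3 then α - γ else α) else 0

/-- For a binary parent the sum is `(1 - α) + γ + (α - γ)`, and otherwise `(1 - α) + α`. This
constant total is what makes the commutation relation close. -/
lemma sum_nearWeight (h : Admissible α γ) (t : LeafTree (n + 2)) (i : Fin (n + 2)) :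
    ∑ x, ENNReal.ofReal (nearWeight α γ t i x) = 1 := by
  obtain ⟨h0, h1, h2⟩ := h
  have hv := parent_mem_branchPoints t i
  rw [← ENNReal.ofReal_sum_of_nonneg, ENNReal.ofReal_eq_one, Fintype.sum_sum_type]
  · simp only [nearWeight]
    rw [Finset.sum_coe_sort t.clades fun C => if C = {i} then 1 - α
      else if C = t.parent {i} ∧ t.numChildren (t.parent {i}) < 3 then γ else 0,
      Finset.sum_coe_sort t.branchPoints fun u => if u = t.parent {i} then
        (if t.numChildren (t.parent {i}) < 3 then α - γ else α) else 0,
      Finset.sum_ite_eq' t.branchPoints, if_pos hv,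
      ← Finset.add_sum_erase _ _ (t.singleton_mem i), if_pos rfl]
    have : ∀ C ∈ t.clades.erase {i}, (if C = {i} then 1 - α
        else if C = t.parent {i} ∧ t.numChildren (t.parent {i}) < 3 then γ else 0) =
        if C = t.parent {i} then (if t.numChildren (t.parent {i}) < 3 then γ else 0) else 0 := by
      intro C hC
      rw [if_neg (Finset.ne_of_mem_erase hC), ite_and]
    rw [Finset.sum_congr rfl this, Finset.sum_ite_eq', if_pos (Finset.mem_erase.2
      ⟨(singleton_ne_parent t i).symm, (Finset.mem_filter.1 hv).1⟩)]
    split_ifs <;> ring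
  · rintro (C | u) - <;> simp only [nearWeight] <;> split_ifs <;> linarith

lemma mem_children_parent_iff {t : LeafTree (n + 2)} {i : Fin (n + 2)} {u : Finset (Fin (n + 2))}
    (hu : u ∈ t.clades) : {i} ∈ t.children u ↔ u = t.parent {i} := by
  obtain ⟨hv, hiv, hmin⟩ := t.parent_spec (t.singleton_mem i) (singleton_ne_univ i)
  constructor
  · intro hi
    have hi' := mem_children.1 hi
    by_contra hne
    exact hi'.2.2 _ (Finset.mem_filter.1 hv).1 (mem_children.1 hiv).2.1
      ((hmin u hu hi'.2.1).ssubset_of_ne (Ne.symm hne))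
  · rintro rfl
    exact hiv

/-- An insertion next to `i` places the new leaf where it can take over the role of `i`. For an edge
at the parent this needs the parent to be binary. -/
lemma swap_delete_last_insertLeaf {t : LeafTree (n + 2)} {i : Fin (n + 2)}
    {x : t.InsertablePart} (hx : t.vertex x = {i} ∨ t.vertex x = t.parent {i} ∧
      (x.isLeft = true → t.numChildren (t.parent {i}) < 3)) :
    ((t.insertLeaf x).swap i.castSucc (Fin.last _)).delete (Fin.last _) = t := by
  refine isRestriction_swapDelete_last_eq (isRestriction_swap_delete _ _ _) ?_ ?_ ?_
  · rcases hx with h1 | ⟨h1, -⟩ <;> rw [h1]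
    · exact Finset.mem_singleton_self i
    · exact t.mem_parent_singleton i
  · intro C hC hi
    rcases hx with h1 | ⟨h1, -⟩ <;> rw [h1]
    · exact Or.inl (Finset.singleton_subset_iff.2 hi)
    · exact t.parent_singleton_subset hC hi
  · intro hl
    rcases hx with h1 | ⟨h1, h2⟩
    · exact Or.inl h1
    · right
      rw [h1, erase_parent_mem_iff]
      exact h2 hl

open scoped Classical in
-- Most parts contribute to only one of the two terms. A parent of `i` with at least three children
-- contributes to both: its weight `(c - 1) α - γ` splits into `α`, for finding the new leaf, and
-- `(c - 2) α - γ`, its weight after one child is lost.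
lemma weight_mul_expect_searchLaw (h : Admissible α γ) (t : LeafTree (n + 2)) (i : Fin (n + 2))
    (f : LeafTree (n + 2) → ℝ≥0∞) (x : t.InsertablePart) :
    ENNReal.ofReal (t.weight α γ x) * expect (searchLaw h (t.insertLeaf x) i.castSucc)
        (fun j => f (((t.insertLeaf x).swap i.castSucc j).delete j)) =
      ENNReal.ofReal (nearWeight α γ t i x) * f t +
        if t.Far i (t.vertex x) then ENNReal.ofReal (t.restWeight α γ i x) *
          expect (searchLaw h t i) (fun j =>
            f (((t.insertLeaf x).swap i.castSucc j.castSucc).delete j.castSucc)) else 0 := by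
  have hv := parent_mem_branchPoints t i
  have hnp := singleton_ne_parent t i
  rcases x with ⟨C, hC⟩ | ⟨u, hu⟩
  · by_cases hCi : C = {i}
    · subst hCi
      rw [vertex_inl, if_neg fun h1 => h1.1 rfl, searchLaw_insertLeaf_edge, expect_pure,
        swap_delete_last_insertLeaf (Or.inl rfl)]
      simp [nearWeight, weight]
    · by_cases hCv : C = t.parent {i} ∧ t.numChildren (t.parent {i}) < 3
      · obtain ⟨rfl, hc⟩ := hCv
        rw [vertex_inl, if_neg fun h1 => ((far_iff hC).1 h1).2 ⟨rfl, hc⟩,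
          searchLaw_insertLeaf_parentEdge h t i hc, expect_pure,
          swap_delete_last_insertLeaf (Or.inr ⟨rfl, fun _ => hc⟩)]
        have hcard := (Finset.mem_filter.1 hv).2
        have hcard' : (t.parent {i}).card ≠ 1 := by omega
        simp [nearWeight, weight, hc, hnp.symm, hcard']
      · have hfar : t.Far i C := (far_iff hC).2 ⟨hCi, hCv⟩
        rw [vertex_inl, if_pos hfar, searchLaw_insertLeaf_far h hfar Sum.inl_ne_inr, expect_map]
        simp only [nearWeight, if_neg hCi, if_neg hCv, ENNReal.ofReal_zero, zero_mul, zero_add]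
        rfl
  · have hui : u ≠ {i} := by
      rintro rfl
      simp [branchPoints] at hu
    by_cases huv : u = t.parent {i}
    · subst huv
      by_cases hc : t.numChildren (t.parent {i}) < 3
      · have h2 : t.numChildren (t.parent {i}) = 2 :=
          le_antisymm (by omega) (t.two_le_numChildren hv)
        rw [vertex_inr, if_neg fun h1 => ((far_iff (Finset.mem_filter.1 hv).1).1 h1).2 ⟨rfl, hc⟩,
          searchLaw_insertLeaf_parent h t i hc, expect_pure,
          swap_delete_last_insertLeaf (Or.inr ⟨rfl, fun _ => hc⟩)]
        simp only [nearWeight, weight, h2, add_zero, if_true]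
        norm_num
      · have hfar : t.Far i (t.parent {i}) :=
          (far_iff (Finset.mem_filter.1 hv).1).2 ⟨hui, fun h1 => hc h1.2⟩
        have hrest : t.restWeight α γ i (.inr ⟨t.parent {i}, hu⟩) =
            ((t.numChildren (t.parent {i}) : ℝ) - 2) * α - γ := by
          have h1 := (mem_children_parent_iff (i := i) (Finset.mem_filter.1 hv).1).2 rfl
          have h2 : 1 ≤ t.numChildren (t.parent {i}) := Finset.card_pos.2 ⟨_, h1⟩
          simp only [restWeight, Finset.card_erase_of_mem h1]
          rw [← numChildren, Nat.cast_sub h2]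
          push_cast
          ring
        rw [vertex_inr, if_pos hfar, hrest]
        refine (expect_searchLaw_insertLeaf_parent h t i (by omega) _).trans ?_
        rw [swap_delete_last_insertLeaf (Or.inr ⟨rfl, by simp⟩)]
        simp [nearWeight, hc]
    · have hucl := (Finset.mem_filter.1 hu).1
      have hfar : t.Far i u := (far_iff hucl).2 ⟨hui, fun h1 => huv h1.1⟩
      have hrest : t.restWeight α γ i (.inr ⟨u, hu⟩) = t.weight α γ (.inr ⟨u, hu⟩) := by
        simp only [restWeight, weight, numChildren]
        rw [Finset.erase_eq_of_notMem fun h1 => huv ((mem_children_parent_iff hucl).1 h1)]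
      rw [vertex_inr, if_pos hfar, hrest, searchLaw_insertLeaf_far h hfar fun h1 => huv ?_, expect_map]
      · simp [nearWeight, huv]
      · exact congrArg Subtype.val (Sum.inr_injective h1)

lemma sum_weight_mul_expect_searchLaw (h : Admissible α γ) (t : LeafTree (n + 2))
    (i : Fin (n + 2)) (f : LeafTree (n + 2) → ℝ≥0∞) :
    ∑ x, ENNReal.ofReal (t.weight α γ x) * expect (searchLaw h (t.insertLeaf x) i.castSucc)
        (fun j => f (((t.insertLeaf x).swap i.castSucc j).delete j)) =
      f t + expect (searchLaw h t i) fun j =>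
        ∑ y, ENNReal.ofReal (((t.swap i j).delete j).weight α γ y) *
          f (((t.swap i j).delete j).insertLeaf y) := by
  classical
  simp only [weight_mul_expect_searchLaw]
  rw [Finset.sum_add_distrib, ← Finset.sum_mul, sum_nearWeight h, one_mul]
  congr 1
  -- For each found leaf `j`, the growth sum over the reduced tree becomes a sum over the far parts
  -- of `t`. This index set and its weights do not depend on `j`, so the two sums can be exchanged.
  have key : ∀ j, ∑ y, ENNReal.ofReal (((t.swap i j).delete j).weight α γ y) *
      f (((t.swap i j).delete j).insertLeaf y) = _ := fun j =>
    (isRestriction_swap_delete t i j).sum_weight_insertLeaf α γ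
      (fun x => ((t.insertLeaf x).swap i.castSucc j.castSucc).delete j.castSucc)
      (fun x => swapDelete_castSucc i j ▸ isRestriction_swap_delete _ _ _) f
  simp only [key, expect_fintype, Finset.mul_sum]
  rw [Finset.sum_comm]
  refine Finset.sum_congr rfl fun x _ => ?_
  split_ifs
  · exact Finset.sum_congr rfl fun j _ => by ring
  · simp

/-! ### The down-step maps the growth process to itself -/

/-- The down-step, given the selected leaf. -/
def downStepFrom (h : Admissible α γ) (i : Fin (n + 2)) (t : LeafTree (n + 2)) :
    PMF (LeafTree (n + 1)) :=
  (searchLaw h t i).map fun j => (t.swap i j).delete j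

lemma expect_upStep (h : Admissible α γ) (t : LeafTree (n + 1)) (f : LeafTree (n + 2) → ℝ≥0∞) :
    expect (upStep h t) f =
      ∑ x, ENNReal.ofReal (t.insertProb α γ x) * f (t.insertLeaf x) := by
  rw [upStep, expect_map, expect_ofFintype]

lemma sub_alpha_pos (h : Admissible α γ) : (0 : ℝ) < (n + 2 : ℕ) - α := by
  have := h.2.2
  push_cast
  have : (0 : ℝ) ≤ n := Nat.cast_nonneg n
  linarith

/-- Multiplying out the normalisation also covers the one-leaf tree with `α = 1`, where both sides
vanish. -/
lemma weight_eq_mul_insertProb (h : Admissible α γ) (t : LeafTree (n + 1))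
    (x : t.InsertablePart) : t.weight α γ x = ((n + 1 : ℕ) - α) * t.insertProb α γ x := by
  cases n with
  | zero =>
    have hcard : ∀ C : Finset (Fin 1), C.card ≤ 1 := fun C => C.card_le_univ
    rcases x with C | u
    · have h1 := (t.nonempty_of_mem C.2).card_pos
      have h2 := hcard C.1
      have h3 : C.1.card = 1 := by omega
      simp [weight, insertProb, h3]
    · have h1 := (Finset.mem_filter.1 u.2).2
      have h2 := hcard u.1
      omega
  | succ n =>
    rw [insertProb, if_neg (by omega), mul_div_cancel₀ _ (sub_alpha_pos h).ne']

lemma sum_weight_mul (h : Admissible α γ) (t : LeafTree (n + 1)) (f : LeafTree (n + 2) → ℝ≥0∞) :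
    ∑ x, ENNReal.ofReal (t.weight α γ x) * f (t.insertLeaf x) =
      ENNReal.ofReal ((n + 1 : ℕ) - α) * expect (upStep h t) f := by
  have h1 : (0 : ℝ) ≤ (n + 1 : ℕ) - α := by
    have := h.2.2
    push_cast
    have : (0 : ℝ) ≤ n := Nat.cast_nonneg n
    linarith
  rw [expect_upStep, Finset.mul_sum]
  refine Finset.sum_congr rfl fun x _ => ?_
  rw [weight_eq_mul_insertProb h, ENNReal.ofReal_mul h1, mul_assoc]

/-- The commutation relation between the growth step and the down-step from a fixed leaf. -/
lemma expect_upStep_downStepFrom (h : Admissible α γ) (t : LeafTree (n + 2)) (i : Fin (n + 2))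
    (f : LeafTree (n + 2) → ℝ≥0∞) :
    ENNReal.ofReal ((n + 2 : ℕ) - α) *
        expect (upStep h t) (fun s => expect (downStepFrom h i.castSucc s) f) =
      f t + ENNReal.ofReal ((n + 1 : ℕ) - α) *
        expect (downStepFrom h i t) (fun s => expect (upStep h s) f) := by
  rw [← sum_weight_mul h t]
  simp only [downStepFrom, expect_map]
  rw [sum_weight_mul_expect_searchLaw h t i f, ← expect_mul_left]
  simp only [sum_weight_mul h]

/-! ### Induction on the number of leaves and invariance -/

instance : Subsingleton (LeafTree 1) where
  allEq s t := by
    have key : ∀ r : LeafTree 1, r.clades = {Finset.univ} := by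
      intro r
      refine Finset.eq_singleton_iff_unique_mem.2 ⟨r.univ_mem, fun C hC => ?_⟩
      obtain ⟨k, hk⟩ := r.nonempty_of_mem hC
      exact Finset.eq_univ_of_forall fun l => Subsingleton.elim k l ▸ hk
    exact LeafTree.ext ((key s).trans (key t).symm)

lemma pmf_eq_of_subsingleton {A : Type*} [Subsingleton A] (p q : PMF A) : p = q := by
  refine pmf_ext_of_expect fun f => ?_
  obtain ⟨a, -⟩ := p.support_nonempty
  have hf : f = fun _ => f a := funext fun b => congrArg f (Subsingleton.elim b a)
  rw [hf, expect_const, expect_const]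

lemma upStep_bind_downStepFrom_last (h : Admissible α γ) (t : LeafTree (n + 2)) :
    (upStep h t).bind (downStepFrom h (Fin.last _)) = PMF.pure t := by
  refine pmf_ext_of_expect fun f => ?_
  have key : ∀ x, expect (downStepFrom h (Fin.last _) (t.insertLeaf x)) f = f t := by
    intro x
    rw [downStepFrom, searchLaw_insertLeaf_last, PMF.pure_map, expect_pure]
    congr 1
    exact isRestriction_castSucc_eq (swapDelete_last_last ▸ isRestriction_swap_delete _ _ _)
  rw [expect_bind, upStep, expect_map, expect_pure]
  simp only [key, expect_const]

/-- For every selected leaf, the down-step maps the law of the growth process with `n + 2` leaves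
to its law with `n + 1` leaves. -/
lemma growthLaw_bind_downStepFrom (h : Admissible α γ) (n : ℕ) (i : Fin (n + 2)) :
    (growthLaw h (n + 1)).bind (downStepFrom h i) = growthLaw h n := by
  induction n with
  | zero => exact pmf_eq_of_subsingleton (A := LeafTree 1) _ _
  | succ n ih =>
    induction i using Fin.lastCases with
    | last =>
      rw [growthLaw, PMF.bind_bind]
      simp only [upStep_bind_downStepFrom_last, PMF.bind_pure]
    | cast i =>
      refine pmf_ext_of_expect fun f => ?_
      have hd := sub_alpha_pos (n := n) h
      have hd1 : (0 : ℝ) ≤ (n + 1 : ℕ) - α := by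
        have := h.2.2
        push_cast
        have : (0 : ℝ) ≤ n := Nat.cast_nonneg n
        linarith
      have hne : ENNReal.ofReal ((n + 2 : ℕ) - α) ≠ 0 := (ENNReal.ofReal_pos.2 hd).ne'
      refine (ENNReal.mul_right_inj hne ENNReal.ofReal_ne_top).1 ?_
      -- Under the growth law, deleting via `i` and growing again changes nothing, by the induction
      -- hypothesis for the same label `i`.
      have ih' : expect (growthLaw h (n + 1)) (fun t => expect (downStepFrom h i t)
          fun s => expect (upStep h s) f) = expect (growthLaw h (n + 1)) f := by
        rw [← expect_bind, ih i, ← expect_bind, growthLaw]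
      rw [growthLaw, PMF.bind_bind, expect_bind, ← expect_mul_left]
      simp only [expect_bind, expect_upStep_downStepFrom]
      -- The two terms now carry the same expectation, with factor `1 + ((n + 1) - α) = (n + 2) -
      -- α`.
      rw [expect_add, expect_mul_left, ih', ← one_add_mul, ← ENNReal.ofReal_one,
        ← ENNReal.ofReal_add zero_le_one hd1]
      congr 2
      push_cast
      ring

/-- The label is chosen independently of the tree, so the two draws may be exchanged; as the outcome
has the same law for each label, the choice of label is immaterial. -/
lemma growthLaw_bind_downStep (h : Admissible α γ) (n : ℕ) :
    (growthLaw h (n + 1)).bind (downStep h) = growthLaw h n := by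
  have : downStep h = fun t : LeafTree (n + 2) =>
      (PMF.uniformOfFintype (Fin (n + 2))).bind fun i => downStepFrom h i t := rfl
  rw [this, PMF.bind_comm]
  simp only [growthLaw_bind_downStepFrom, PMF.bind_const]

lemma growthLaw_bind_chainKernel (h : Admissible α γ) (n : ℕ) :
    (growthLaw h n).bind (chainKernel h n) = growthLaw h n := by
  cases n with
  | zero => exact PMF.bind_pure _
  | succ n =>
    have : chainKernel h (n + 1) = fun t => (downStep h t).bind (upStep h) := rfl
    rw [this, ← PMF.bind_bind, growthLaw_bind_downStep, growthLaw]

end AlphaGamma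

end

theorem mainTheorem9 (α γ : ℝ) (h : AlphaGamma.Admissible α γ) (n : ℕ) :
    (AlphaGamma.growthLaw h n).bind (AlphaGamma.chainKernel h n) = AlphaGamma.growthLaw h n ∧
    ∀ {Ω : Type*} [MeasurableSpace Ω] (P : MeasureTheory.Measure Ω)
      [MeasureTheory.IsProbabilityMeasure P] (X : ℕ → Ω → AlphaGamma.LeafTree (n + 1)),
      AlphaGamma.IsMarkovChain P X (AlphaGamma.growthLaw h n) (AlphaGamma.chainKernel h n) →
        AlphaGamma.IsStationary P X := by
  refine ⟨AlphaGamma.growthLaw_bind_chainKernel h n, fun P _ X hX => ?_⟩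
  have : DiscreteMeasurableSpace (AlphaGamma.LeafTree (n + 1)) := ⟨fun _ => trivial⟩
  exact hX.isStationary (AlphaGamma.growthLaw_bind_chainKernel h n)
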